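/- Let $n\ge 1$, let $X=[0,1]^n$ with the Euclidean metric, let $0<\gamma<\alpha<1$, and let $$c_\alpha(x,x')=e^{-\|x-x'\|^{2\alpha}/2},\qquad x,x'\in X.$$ Spaces. Let $X^\gamma$ be $X$ with the metric $\|x-x'\|^\gamma$, and let $X^\gamma\times X^\gamma$ carry the metric $\rho((x,x'),(y,y'))=\max\{\|x-y\|^\gamma,\|x'-y'\|^\gamma\}$. For a compact metric space $(M,\rho)$, $\mathrm{Lip}(M)$ is the space of Lipschitz functions $f:M\to\mathbb R$ with the norm $\max\{\|f\|_\infty,L(f)\}$, where $L(f)$ is the Lipschitz constant, and $\mathrm{lip}(M)$ is its subspace of all $f$ with $\sup\{|f(p)-f(q)|/\rho(p,q): 0<\rho(p,q)<\delta\}\to0$ as $\delta\to0$, with the same norm. Faber–Schauder system. Let $\psi(t)=1-|t|$ for $|t|\le1$ and $\psi(t)=0$ otherwise; $D_0=\{0,1\}$ and $D_k=\{(2p-1)2^{-k}: p=1,\dots,2^{k-1}\}$ for $k\ge1$; and let $D_k^n$ be the set of $\tau\in X$ all of whose coordinates lie in $D_0\cup\dots\cup D_k$ and at least one of whose coordinates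 lies in $D_k$. For $\tau\in D^n_k$ put $$\tilde f_\tau(x)=2^{-\gamma k}\prod_{i=1}^n\psi(2^k(x_i-\tau_i)),$$ $$\tilde\mu_\tau=\delta_\tau\ \text{ if } k=0,\qquad \tilde\mu_\tau=2^{\gamma k-n}\sum_{\varepsilon\in\{-1,1\}^n}(\delta_\tau-\delta_{\tau^\varepsilon})\ \text{ if } k\ge1,$$ where $\tau^\varepsilon_i=\tau_i+\varepsilon_i2^{-k}$ if $\tau_i\in D_k$ and $\tau^\varepsilon_i=\tau_i$ otherwise. Write $(f\otimes g)(x,x')=f(x)g(x')$ and $\langle\mu,g\rangle=\int g\,d\mu$. Claim. The function $c_\alpha$ and all functions $\tilde f_\tau\otimes\tilde f_t$ ($\tau,t\in\bigcup_kD_k^n$) belong to $\mathrm{lip}(X^\gamma\times X^\gamma)$, and $$c_\alpha=\sum_{\tau,t}\langle\tilde\mu_\tau\otimes\tilde\mu_t,c_\alpha\rangle\,\tilde f_\tau\otimes\tilde f_t,$$ where the series over all pairs $(\tau,t)$ converges (unconditionally, hence in every enumeration of the pairs) in the norm of $\mathrm{lip}(X^\gamma\times X^\gamma)$. -/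

import Mathlib

noncomputable section

namespace HolderFaber

/-! ### Lipschitz and little Lipschitz spaces of a metric space -/

section LipschitzSpaces

/-- The (bounded) Lipschitz functions on `M`, as a linear space. On a compact `M` boundedness is
automatic. -/
def lipSubmodule (M : Type*) [MetricSpace M] : Submodule ℝ (M → ℝ) where
  carrier := {f | (∃ C : ℝ, ∀ x, |f x| ≤ C) ∧ ∃ K : ℝ, ∀ x y, |f x - f y| ≤ K * dist x y}
  zero_mem' := ⟨⟨0, fun x => by simp⟩, 0, fun x y => by simp⟩
  add_mem' := by
    rintro f g ⟨⟨C, hC⟩, K, hK⟩ ⟨⟨C', hC'⟩, K', hK'⟩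
    refine ⟨⟨C + C', fun x => ?_⟩, K + K', fun x y => ?_⟩
    · exact (abs_add_le (f x) (g x)).trans (add_le_add (hC x) (hC' x))
    · have h : (f + g) x - (f + g) y = (f x - f y) + (g x - g y) := by
        simp only [Pi.add_apply]; ring
      rw [h, add_mul]
      exact (abs_add_le _ _).trans (add_le_add (hK x y) (hK' x y))
  smul_mem' := by
    rintro c f ⟨⟨C, hC⟩, K, hK⟩
    refine ⟨⟨|c| * C, fun x => ?_⟩, |c| * K, fun x y => ?_⟩
    · simp only [Pi.smul_apply, smul_eq_mul, abs_mul]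
      exact mul_le_mul_of_nonneg_left (hC x) (abs_nonneg c)
    · simp only [Pi.smul_apply, smul_eq_mul]
      rw [← mul_sub, abs_mul, mul_assoc]
      exact mul_le_mul_of_nonneg_left (hK x y) (abs_nonneg c)

/-- The space `Lip(M)`. It is a copy of `lipSubmodule M`, so that it does not inherit the topology
of pointwise convergence from `M → ℝ`; its topology is the one of the norm below. -/
def LipSpace (M : Type*) [MetricSpace M] : Type _ := lipSubmodule M

variable {M : Type*} [MetricSpace M]

instance : AddCommGroup (LipSpace M) := inferInstanceAs (AddCommGroup (lipSubmodule M))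

instance : Module ℝ (LipSpace M) := inferInstanceAs (Module ℝ (lipSubmodule M))

instance : CoeFun (LipSpace M) (fun _ => M → ℝ) := ⟨fun f => f.1⟩

/-- The supremum norm `‖f‖_∞`. -/
def supNorm (f : M → ℝ) : ℝ := ⨆ x, |f x|

/-- The Lipschitz constant `L(f)`; the quotient is `0` on the diagonal. -/
def lipConst (f : M → ℝ) : ℝ := ⨆ p : M × M, |f p.1 - f p.2| / dist p.1 p.2

/-- `‖f‖ = max {‖f‖_∞, L(f)}`. -/
instance : Norm (LipSpace M) := ⟨fun f => max (supNorm f) (lipConst f)⟩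

theorem LipSpace.norm_def (f : LipSpace M) : ‖f‖ = max (supNorm f) (lipConst f) := rfl

theorem LipSpace.bddAbove_sup (f : LipSpace M) : BddAbove (Set.range fun x => |f x|) := by
  obtain ⟨C, hC⟩ := f.2.1
  exact ⟨C, by rintro _ ⟨x, rfl⟩; exact hC x⟩

theorem LipSpace.bddAbove_lip (f : LipSpace M) :
    BddAbove (Set.range fun p : M × M => |f p.1 - f p.2| / dist p.1 p.2) := by
  obtain ⟨K, hK⟩ := f.2.2
  refine ⟨max K 0, ?_⟩
  rintro _ ⟨p, rfl⟩
  refine div_le_of_le_mul₀ dist_nonneg (le_max_right _ _) ((hK p.1 p.2).trans ?_)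
  exact mul_le_mul_of_nonneg_right (le_max_left _ _) dist_nonneg

theorem LipSpace.abs_apply_le_norm (f : LipSpace M) (x : M) : |f x| ≤ ‖f‖ :=
  (le_ciSup f.bddAbove_sup x).trans (le_max_left _ _)

theorem LipSpace.quot_le_norm (f : LipSpace M) (x y : M) : |f x - f y| / dist x y ≤ ‖f‖ :=
  (le_ciSup f.bddAbove_lip (x, y)).trans (le_max_right _ _)

theorem LipSpace.norm_nonneg' (f : LipSpace M) : 0 ≤ ‖f‖ :=
  le_max_of_le_left (Real.iSup_nonneg fun _ => abs_nonneg _)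

theorem LipSpace.norm_le_of {f : LipSpace M} {B : ℝ} (hB : 0 ≤ B) (h1 : ∀ x, |f x| ≤ B)
    (h2 : ∀ x y, |f x - f y| / dist x y ≤ B) : ‖f‖ ≤ B :=
  max_le (Real.iSup_le h1 hB) (Real.iSup_le (fun p => h2 p.1 p.2) hB)

theorem LipSpace.add_apply (f g : LipSpace M) (x : M) : (f + g) x = f x + g x := rfl

theorem LipSpace.smul_apply (c : ℝ) (f : LipSpace M) (x : M) : (c • f) x = c * f x := rfl

theorem LipSpace.norm_smul_le' (c : ℝ) (f : LipSpace M) : ‖c • f‖ ≤ |c| * ‖f‖ := by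
  refine LipSpace.norm_le_of (mul_nonneg (abs_nonneg c) f.norm_nonneg') (fun x => ?_)
    (fun x y => ?_)
  · rw [LipSpace.smul_apply, abs_mul]
    exact mul_le_mul_of_nonneg_left (f.abs_apply_le_norm x) (abs_nonneg c)
  · rw [LipSpace.smul_apply, LipSpace.smul_apply, ← mul_sub, abs_mul, mul_div_assoc]
    exact mul_le_mul_of_nonneg_left (f.quot_le_norm x y) (abs_nonneg c)

theorem LipSpace.normCore : NormedSpace.Core ℝ (LipSpace M) where
  norm_nonneg := LipSpace.norm_nonneg'
  norm_smul := fun c f => by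
    refine le_antisymm (LipSpace.norm_smul_le' c f) ?_
    rcases eq_or_ne c 0 with rfl | hc
    · simpa using LipSpace.norm_nonneg' ((0 : ℝ) • f)
    · have h := LipSpace.norm_smul_le' c⁻¹ (c • f)
      rw [smul_smul, inv_mul_cancel₀ hc, one_smul, abs_inv] at h
      rw [Real.norm_eq_abs]
      have hc' : 0 < |c| := abs_pos.2 hc
      calc |c| * ‖f‖ ≤ |c| * (|c|⁻¹ * ‖c • f‖) := mul_le_mul_of_nonneg_left h hc'.le
        _ = ‖c • f‖ := by rw [← mul_assoc, mul_inv_cancel₀ hc'.ne', one_mul]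
  norm_triangle := fun f g => by
    refine LipSpace.norm_le_of (add_nonneg f.norm_nonneg' g.norm_nonneg') (fun x => ?_)
      (fun x y => ?_)
    · exact (abs_add_le (f x) (g x)).trans
        (add_le_add (f.abs_apply_le_norm x) (g.abs_apply_le_norm x))
    · have h : (f + g) x - (f + g) y = (f x - f y) + (g x - g y) := by
        simp only [LipSpace.add_apply]; ring
      rw [h]
      refine le_trans (div_le_div_of_nonneg_right (abs_add_le _ _) dist_nonneg) ?_
      rw [add_div]
      exact add_le_add (f.quot_le_norm x y) (g.quot_le_norm x y)
  norm_eq_zero_iff := fun f => by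
    constructor
    · intro h
      refine Subtype.ext (funext fun x => ?_)
      have hx := f.abs_apply_le_norm x
      rw [h] at hx
      exact abs_eq_zero.1 (le_antisymm hx (abs_nonneg _))
    · rintro rfl
      have h := LipSpace.norm_smul_le' (0 : ℝ) (0 : LipSpace M)
      rw [smul_zero, abs_zero, zero_mul] at h
      exact le_antisymm h (LipSpace.norm_nonneg' _)

instance : NormedAddCommGroup (LipSpace M) := NormedAddCommGroup.ofCore LipSpace.normCore

instance : NormedSpace ℝ (LipSpace M) := NormedSpace.ofCore LipSpace.normCore

/-- The space `lip(M)` of locally flat Lipschitz functions,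
`sup {|f x - f y| / d(x, y) : 0 < d(x, y) < δ} → 0` as `δ → 0`, with the norm of `Lip(M)`. -/
def littleLip (M : Type*) [MetricSpace M] : Submodule ℝ (LipSpace M) where
  carrier := {f | ∀ ε : ℝ, 0 < ε → ∃ δ : ℝ, 0 < δ ∧
    ∀ x y : M, 0 < dist x y → dist x y < δ → |f x - f y| / dist x y ≤ ε}
  zero_mem' := fun ε hε => ⟨1, one_pos, fun x y _ _ => by
    change |(0 : ℝ) - 0| / dist x y ≤ ε
    simpa using hε.le⟩
  add_mem' := by
    intro f g hf hg ε hε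
    obtain ⟨δ, hδ, h⟩ := hf (ε / 2) (half_pos hε)
    obtain ⟨δ', hδ', h'⟩ := hg (ε / 2) (half_pos hε)
    refine ⟨min δ δ', lt_min hδ hδ', fun x y h0 hxy => ?_⟩
    have e : (f + g) x - (f + g) y = (f x - f y) + (g x - g y) := by
      simp only [LipSpace.add_apply]; ring
    rw [e]
    refine le_trans (div_le_div_of_nonneg_right (abs_add_le _ _) dist_nonneg) ?_
    rw [add_div]
    have h1 := h x y h0 (hxy.trans_le (min_le_left _ _))
    have h2 := h' x y h0 (hxy.trans_le (min_le_right _ _))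
    linarith
  smul_mem' := by
    intro c f hf ε hε
    have hc : 0 < |c| + 1 := by positivity
    obtain ⟨δ, hδ, h⟩ := hf (ε / (|c| + 1)) (div_pos hε hc)
    refine ⟨δ, hδ, fun x y h0 hxy => ?_⟩
    rw [LipSpace.smul_apply, LipSpace.smul_apply, ← mul_sub, abs_mul, mul_div_assoc]
    calc |c| * (|f x - f y| / dist x y) ≤ |c| * (ε / (|c| + 1)) :=
          mul_le_mul_of_nonneg_left (h x y h0 hxy) (abs_nonneg c)
      _ ≤ (|c| + 1) * (ε / (|c| + 1)) :=
          mul_le_mul_of_nonneg_right (by linarith) (div_pos hε hc).le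
      _ = ε := mul_div_cancel₀ ε hc.ne'

end LipschitzSpaces

/-! ### The cube, its snowflake and the exponential kernel -/

/-- The cube `X = [0,1]^n` with the Euclidean metric. -/
abbrev Cube (n : ℕ) : Type :=
  {x : EuclideanSpace ℝ (Fin n) // ∀ i, 0 ≤ x i ∧ x i ≤ 1}

/-- The metric space `X^γ × X^γ`, where `X^γ = ([0,1]^n, ‖x - x'‖^γ)`, with the metric
`max {‖x - y‖^γ, ‖x' - y'‖^γ}` between the points `(x, x')` and `(y, y')`. -/
abbrev SnowCubeSq (n : ℕ) (γ : ℝ) (h0 : 0 < γ) (h1 : γ ≤ 1) : Type :=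
  Metric.Snowflaking (Cube n) γ h0 h1 × Metric.Snowflaking (Cube n) γ h0 h1

/-- The underlying point of `X × X`. -/
def SnowCubeSq.toPair {n : ℕ} {γ : ℝ} {h0 : 0 < γ} {h1 : γ ≤ 1} (p : SnowCubeSq n γ h0 h1) :
    Cube n × Cube n :=
  (p.1.ofSnowflaking, p.2.ofSnowflaking)

/-- The kernel `c_α(x, x') = exp (- ‖x - x'‖^(2α) / 2)`. -/
def expKernel (n : ℕ) (α : ℝ) (p : Cube n × Cube n) : ℝ :=
  Real.exp (-(‖p.1.1 - p.2.1‖ ^ (2 * α) / 2))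

/-! ### The Faber–Schauder system -/

/-- The hat function `ψ`. -/
def hat (t : ℝ) : ℝ := if |t| ≤ 1 then 1 - |t| else 0

/-- `D_0 = {0, 1}` and `D_k = {(2p - 1) 2^{-k} : p = 1, …, 2^{k-1}}` for `k ≥ 1`. -/
def dyadic : ℕ → Set ℝ
  | 0 => {0, 1}
  | k + 1 => {x | ∃ p : ℕ, 1 ≤ p ∧ p ≤ 2 ^ k ∧ x = (2 * (p : ℝ) - 1) / 2 ^ (k + 1)}

/-- `D_k^n`: all coordinates lie in `D_0 ∪ … ∪ D_k`, and at least one of them in `D_k`. -/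
def dyadicNodes (n k : ℕ) : Set (Cube n) :=
  {τ | (∀ i, ∃ j ≤ k, τ.1 i ∈ dyadic j) ∧ ∃ i, τ.1 i ∈ dyadic k}

/-- The index set `⋃_k D_k^n` (a disjoint union): a node together with its level. -/
abbrev FaberIndex (n : ℕ) : Type := Σ k : ℕ, {τ : Cube n // τ ∈ dyadicNodes n k}

/-- The normalised Faber–Schauder function
`f̃_τ(x) = 2^{-γk} ∏ᵢ ψ(2^k (xᵢ - τᵢ))`, `τ ∈ D_k^n`. -/
def faber {n : ℕ} (γ : ℝ) (τ : FaberIndex n) (x : Cube n) : ℝ :=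
  (2 : ℝ) ^ (-(γ * (τ.1 : ℝ))) * ∏ i, hat (2 ^ τ.1 * (x.1 i - τ.2.1.1 i))

theorem dyadic_succ_add_mem {k : ℕ} {x : ℝ} (hx : x ∈ dyadic (k + 1)) (e : ℤˣ) :
    0 ≤ x + ((e : ℤ) : ℝ) / 2 ^ (k + 1) ∧ x + ((e : ℤ) : ℝ) / 2 ^ (k + 1) ≤ 1 := by
  obtain ⟨p, hp1, hp2, rfl⟩ := hx
  have hp1' : (1 : ℝ) ≤ p := by exact_mod_cast hp1
  have hp2' : (p : ℝ) ≤ 2 ^ k := by exact_mod_cast hp2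
  have h2 : (0 : ℝ) < 2 ^ (k + 1) := by positivity
  rw [← add_div]
  constructor
  · apply div_nonneg _ h2.le
    rcases Int.units_eq_one_or e with rfl | rfl <;> push_cast <;> linarith
  · rw [div_le_one h2, pow_succ]
    rcases Int.units_eq_one_or e with rfl | rfl <;> push_cast <;> linarith

open Classical in
/-- The neighbour `τ^ε` of a node `τ ∈ D_{k+1}^n`, where `ε ∈ {-1, 1}^n`:
`τᵢ^ε = τᵢ + εᵢ 2^{-(k+1)}` if `τᵢ ∈ D_{k+1}`, and `τᵢ^ε = τᵢ` otherwise. -/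
def neighbour {n : ℕ} (k : ℕ) (τ : Cube n) (ε : Fin n → ℤˣ) : Cube n :=
  ⟨WithLp.toLp 2 fun i =>
      if τ.1 i ∈ dyadic (k + 1) then τ.1 i + ((ε i : ℤ) : ℝ) / 2 ^ (k + 1) else τ.1 i, by
    intro i
    change 0 ≤ (if τ.1 i ∈ dyadic (k + 1) then _ else _) ∧
      (if τ.1 i ∈ dyadic (k + 1) then _ else _) ≤ 1
    split_ifs with h
    · exact dyadic_succ_add_mem h (ε i)
    · exact τ.2 i⟩

/-- A finitely supported signed measure on `Y`; `Finsupp.single y a` is `a δ_y`. -/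
abbrev DiscMeasure (Y : Type*) : Type _ := Y →₀ ℝ

/-- The pairing `⟨μ, g⟩ = ∫ g dμ = ∑_y μ({y}) g(y)`. -/
def DiscMeasure.pair {Y : Type*} (μ : DiscMeasure Y) (g : Y → ℝ) : ℝ := μ.sum fun y a => a * g y

/-- The product measure `μ ⊗ ν`. -/
def DiscMeasure.tensor {Y Z : Type*} (μ : DiscMeasure Y) (ν : DiscMeasure Z) :
    DiscMeasure (Y × Z) :=
  μ.sum fun y a => ν.sum fun z b => Finsupp.single (y, z) (a * b)

/-- The normalised coefficient functional: `μ̃_τ = δ_τ` for `τ ∈ D_0^n`, and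
`μ̃_τ = 2^{γk - n} ∑_ε (δ_τ - δ_{τ^ε})` for `τ ∈ D_k^n`, `k ≥ 1`. -/
def faberCoeff {n : ℕ} (γ : ℝ) : FaberIndex n → DiscMeasure (Cube n)
  | ⟨0, τ⟩ => Finsupp.single τ.1 1
  | ⟨k + 1, τ⟩ => (2 : ℝ) ^ (γ * ((k + 1 : ℕ) : ℝ) - (n : ℝ)) •
      ∑ ε : Fin n → ℤˣ,
        (Finsupp.single τ.1 (1 : ℝ) - Finsupp.single (neighbour k τ.1 ε) (1 : ℝ))

/-- The function `(f ⊗ g)(x, x') = f(x) g(x')`. -/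
def tensorFun {Y Z : Type*} (f : Y → ℝ) (g : Z → ℝ) (p : Y × Z) : ℝ := f p.1 * g p.2

end HolderFaber

end

/-!
The kernel `c` is Hölder continuous of an exponent larger than `γ`, namely `α`
(`abs_expKernel_sub_le`): `a ^ (2α) - b ^ (2α) = (a ^ α - b ^ α) (a ^ α + b ^ α)`, and the second
factor is bounded on the cube. This margin between `γ` and `α` gives membership in the little
Lipschitz space as well as the convergence of the series.

*Identification of the sum.* The refinement equation of the hat function shows that the
Faber–Schauder terms of level `k + 1` add up to the difference of the multilinear interpolations on
the dyadic grids of levels `k + 1` and `k` (`interp_succ_sub_interp`). Hence the sum over all nodes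
up to level `K` is the interpolation on the grid of level `K` (`sum_nodesUpTo`), and the sum over
all pairs of such nodes is the interpolation in both variables (`sum_nodesUpTo_product`). It
converges pointwise to `c`, because the hat functions of one level form a partition of unity with
small supports (`tendsto_sum_expKernel`).

*Unconditional convergence.* Consider pairs of nodes of levels `(k, l)`. A coefficient functional is
a multiple of an average of differences, so by Hölder continuity the coefficients are
`O(2 ^ (γ (k + l) - α max(k, l)))` (`abs_coeff_expKernel_le`). Since the hat functions of one level
have supports of bounded overlap, the sum of the absolute values of all functions at these levels,
and that of the absolute values of their increments divided by the distance, are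
`O(2 ^ (-γ k) + 2 ^ (-γ l))` (`sum_abs_tensorFun_faber_le`, `sum_abs_tensorFun_faber_sub_le`). The
product is `O(r ^ (k + l))` with `r = 2 ^ (-(α - γ) / 2) < 1`. So any finite partial sum is bounded
in norm by a sum of a summable function over the pairs of levels that occur in it
(`norm_sum_faberLip_le`), and the net of partial sums is Cauchy (`cauchySeq_of_levels`).

The Lipschitz norm is lower semicontinuous under pointwise convergence, so a Cauchy net of partial
sums converges in norm to its pointwise limit (`LipSpace.hasSum_of_cauchySeq`); completeness of the
space is not needed.
-/

noncomputable section

namespace HolderFaber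

open Filter Topology

/-! ### The hat function on dyadic grids -/

theorem hat_eq_max (t : ℝ) : hat t = max 0 (1 - |t|) := by
  unfold hat
  split_ifs with h
  · rw [max_eq_right (by linarith)]
  · rw [max_eq_left (by linarith)]

theorem hat_nonneg (t : ℝ) : 0 ≤ hat t := by
  rw [hat_eq_max]; exact le_max_left _ _

theorem hat_le_one (t : ℝ) : hat t ≤ 1 := by
  rw [hat_eq_max]; exact max_le zero_le_one (by linarith [abs_nonneg t])

theorem hat_eq_zero {t : ℝ} (h : 1 ≤ |t|) : hat t = 0 := by
  rw [hat_eq_max, max_eq_left (by linarith)]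

theorem abs_hat_sub_hat_le (s t : ℝ) : |hat s - hat t| ≤ |s - t| := by
  rw [hat_eq_max, hat_eq_max]
  refine (abs_max_sub_max_le_max _ _ _ _).trans (max_le (by simp) ?_)
  rw [show (1 - |s|) - (1 - |t|) = |t| - |s| by ring, abs_sub_comm s t]
  exact abs_abs_sub_abs_le _ _

/-- A point of `[0, N]` lies in one of the unit cells. -/
theorem exists_cell {N : ℕ} (hN : 1 ≤ N) {y : ℝ} (h0 : 0 ≤ y) (h1 : y ≤ N) :
    ∃ j < N, ∃ s : ℝ, 0 ≤ s ∧ s ≤ 1 ∧ y = j + s := by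
  rcases lt_or_eq_of_le h1 with h | h
  · refine ⟨⌊y⌋₊, (Nat.floor_lt h0).2 h, y - ⌊y⌋₊, ?_, ?_, by ring⟩
    · linarith [Nat.floor_le h0]
    · linarith [Nat.lt_floor_add_one y]
  · refine ⟨N - 1, by omega, 1, zero_le_one, le_rfl, ?_⟩
    rw [h, Nat.cast_sub hN]; simp

/-- Hat functions centred at the integers reproduce the functions that are affine on each unit
cell. -/
theorem sum_mul_hat_eq {N : ℕ} (hN : 1 ≤ N) {h : ℝ → ℝ}
    (haff : ∀ j < N, ∀ s : ℝ, 0 ≤ s → s ≤ 1 → h (j + s) = (1 - s) * h j + s * h (j + 1))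
    {y : ℝ} (h0 : 0 ≤ y) (h1 : y ≤ N) :
    ∑ j ∈ Finset.range (N + 1), h j * hat (y - j) = h y := by
  obtain ⟨j, hj, s, hs0, hs1, rfl⟩ := exists_cell hN h0 h1
  rw [Finset.sum_eq_add j (j + 1) (by omega)]
  · have e1 : hat ((j : ℝ) + s - j) = 1 - s := by
      rw [hat_eq_max, show (j : ℝ) + s - j = s by ring, abs_of_nonneg hs0,
        max_eq_right (by linarith)]
    have e2 : hat ((j : ℝ) + s - (j + 1 : ℕ)) = s := by
      rw [hat_eq_max, show (j : ℝ) + s - (j + 1 : ℕ) = -(1 - s) by push_cast; ring, abs_neg,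
        abs_of_nonneg (by linarith), max_eq_right (by linarith)]
      ring
    rw [e1, e2, haff j hj s hs0 hs1]
    push_cast
    ring
  · rintro i - ⟨h1, h2⟩
    rw [hat_eq_zero, mul_zero]
    rcases lt_or_gt_of_ne h1 with h | h
    · have : (i : ℝ) + 1 ≤ j := by exact_mod_cast h
      exact le_trans (by linarith) (le_abs_self _)
    · have : (j : ℝ) + 2 ≤ i := by exact_mod_cast (show j + 2 ≤ i by omega)
      exact le_trans (by linarith) (neg_le_abs _)
  · intro h; exact absurd (Finset.mem_range.2 (by omega)) h
  · intro h; exact absurd (Finset.mem_range.2 (by omega)) h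

/-- The dyadic grid `{m 2^{-k} : m = 0, …, 2^k}`. -/
def grid (k : ℕ) : Finset ℝ :=
  (Finset.range (2 ^ k + 1)).image fun m : ℕ => (m : ℝ) / 2 ^ k

theorem mem_grid {k : ℕ} {x : ℝ} : x ∈ grid k ↔ ∃ m : ℕ, m ≤ 2 ^ k ∧ x = m / 2 ^ k := by
  simp only [grid, Finset.mem_image, Finset.mem_range, Nat.lt_succ_iff]
  exact ⟨fun ⟨m, h, e⟩ => ⟨m, h, e.symm⟩, fun ⟨m, h, e⟩ => ⟨m, h, e.symm⟩⟩

theorem sum_grid (k : ℕ) (f : ℝ → ℝ) :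
    ∑ t ∈ grid k, f t = ∑ m ∈ Finset.range (2 ^ k + 1), f ((m : ℝ) / 2 ^ k) := by
  refine Finset.sum_image fun a _ b _ h => ?_
  have h2 : (2 : ℝ) ^ k ≠ 0 := by positivity
  exact_mod_cast (div_left_inj' h2).1 h

theorem grid_nonneg_le_one {k : ℕ} {x : ℝ} (hx : x ∈ grid k) : 0 ≤ x ∧ x ≤ 1 := by
  obtain ⟨m, hm, rfl⟩ := mem_grid.1 hx
  refine ⟨by positivity, div_le_one_of_le₀ (by exact_mod_cast hm) (by positivity)⟩

theorem grid_mono {j k : ℕ} (h : j ≤ k) : grid j ⊆ grid k := by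
  intro x hx
  obtain ⟨m, hm, rfl⟩ := mem_grid.1 hx
  refine mem_grid.2 ⟨m * 2 ^ (k - j), ?_, ?_⟩
  · calc m * 2 ^ (k - j) ≤ 2 ^ j * 2 ^ (k - j) := Nat.mul_le_mul_right _ hm
      _ = 2 ^ k := by rw [← pow_add, Nat.add_sub_cancel' h]
  · rw [div_eq_div_iff (by positivity) (by positivity)]
    push_cast
    rw [mul_assoc, ← pow_add, Nat.sub_add_cancel h]

theorem dyadic_subset_grid (k : ℕ) : dyadic k ⊆ grid k := by
  cases k with
  | zero =>
    rintro x (rfl | rfl)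
    · exact mem_grid.2 ⟨0, by simp, by simp⟩
    · exact mem_grid.2 ⟨1, by simp, by simp⟩
  | succ k =>
    rintro x ⟨p, h1, h2, rfl⟩
    refine mem_grid.2 ⟨2 * p - 1, by rw [pow_succ]; omega, ?_⟩
    rw [Nat.cast_sub (by omega)]; push_cast; rfl

theorem not_mem_dyadic_succ_of_mem_grid {k : ℕ} {x : ℝ} (hx : x ∈ grid k) :
    x ∉ dyadic (k + 1) := by
  rintro ⟨p, -, -, e⟩
  obtain ⟨m, -, rfl⟩ := mem_grid.1 hx
  rw [div_eq_div_iff (by positivity) (by positivity), pow_succ, mul_comm _ (2 : ℝ), ← mul_assoc]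
    at e
  have e' := mul_right_cancel₀ (by positivity) e
  have : (m * 2 : ℤ) = 2 * p - 1 := by exact_mod_cast e'
  omega

/-- The nodes of `D_{k+1}` are the points by which the grid of level `k + 1` refines the grid of
level `k`. -/
theorem mem_grid_succ {k : ℕ} {x : ℝ} :
    x ∈ grid (k + 1) ↔ x ∈ grid k ∨ x ∈ dyadic (k + 1) := by
  constructor
  · intro hx
    obtain ⟨m, hm, rfl⟩ := mem_grid.1 hx
    rw [pow_succ] at hm
    rcases Nat.even_or_odd' m with ⟨p, rfl | rfl⟩
    · refine Or.inl (mem_grid.2 ⟨p, by omega, ?_⟩)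
      rw [pow_succ, div_eq_div_iff (by positivity) (by positivity)]
      push_cast; ring
    · refine Or.inr ⟨p + 1, by omega, by omega, ?_⟩
      push_cast; congr 1; ring
  · rintro (h | h)
    · exact grid_mono k.le_succ h
    · exact dyadic_subset_grid _ h

theorem mem_grid_iff {k : ℕ} {x : ℝ} : x ∈ grid k ↔ ∃ j ≤ k, x ∈ dyadic j := by
  constructor
  · induction k with
    | zero =>
      intro hx
      obtain ⟨m, hm, rfl⟩ := mem_grid.1 hx
      refine ⟨0, le_rfl, ?_⟩
      interval_cases m <;> simp [dyadic]
    | succ k ih =>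
      intro hx
      rcases mem_grid_succ.1 hx with h | h
      · obtain ⟨j, hj, h⟩ := ih h
        exact ⟨j, hj.trans k.le_succ, h⟩
      · exact ⟨k + 1, le_rfl, h⟩
  · rintro ⟨j, hj, h⟩
    exact grid_mono hj (dyadic_subset_grid _ h)

/-- The hat functions of one level form a partition of unity of `[0, 1]`. -/
theorem sum_grid_hat (k : ℕ) {x : ℝ} (h0 : 0 ≤ x) (h1 : x ≤ 1) :
    ∑ t ∈ grid k, hat (2 ^ k * (x - t)) = 1 := by
  have h2 : (0 : ℝ) < 2 ^ k := by positivity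
  have key := sum_mul_hat_eq (N := 2 ^ k) Nat.one_le_two_pow (h := fun _ => 1)
    (fun _ _ s _ _ => by ring) (y := 2 ^ k * x) (by positivity)
    (by push_cast; exact mul_le_of_le_one_right h2.le h1)
  rw [sum_grid, ← key]
  refine Finset.sum_congr rfl fun m _ => ?_
  rw [one_mul, mul_sub, mul_div_cancel₀ _ h2.ne']

/-- A hat function of integer centre is affine between consecutive half-integers. -/
theorem hat_affine_half (a : ℤ) {s : ℝ} (h0 : 0 ≤ s) (h1 : s ≤ 1) :
    hat ((a + s) / 2) = (1 - s) * hat (a / 2) + s * hat ((a + 1) / 2) := by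
  rcases le_or_gt 2 a with h | h
  · have : (2 : ℝ) ≤ a := by exact_mod_cast h
    rw [hat_eq_zero, hat_eq_zero, hat_eq_zero]
    · ring
    all_goals exact le_trans (by linarith) (le_abs_self _)
  rcases le_or_gt a (-3) with h' | h'
  · have : (a : ℝ) ≤ -3 := by exact_mod_cast h'
    rw [hat_eq_zero, hat_eq_zero, hat_eq_zero]
    · ring
    all_goals exact le_trans (by linarith) (neg_le_abs _)
  simp only [hat_eq_max]
  interval_cases a <;> push_cast
  · rw [abs_of_nonpos (by linarith), abs_of_nonpos (by norm_num), abs_of_nonpos (by norm_num),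
      max_eq_right (by linarith), max_eq_right (by norm_num), max_eq_right (by norm_num)]
    ring
  · rw [abs_of_nonpos (by linarith), abs_of_nonpos (by norm_num), abs_of_nonpos (by norm_num),
      max_eq_right (by linarith), max_eq_right (by norm_num), max_eq_right (by norm_num)]
    ring
  · rw [abs_of_nonneg (by linarith), abs_of_nonneg (by norm_num), abs_of_nonneg (by norm_num),
      max_eq_right (by linarith), max_eq_right (by norm_num), max_eq_right (by norm_num)]
    ring
  · rw [abs_of_nonneg (by linarith), abs_of_nonneg (by norm_num), abs_of_nonneg (by norm_num),
      max_eq_right (by linarith), max_eq_right (by norm_num), max_eq_right (by norm_num)]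
    ring

/-- The refinement equation: on `[0, 1]`, a hat function of level `k` is interpolated exactly by
the hat functions of level `k + 1`. -/
theorem sum_grid_succ_hat_mul_hat {k : ℕ} {t : ℝ} (ht : t ∈ grid k) {x : ℝ} (h0 : 0 ≤ x)
    (h1 : x ≤ 1) :
    ∑ s ∈ grid (k + 1), hat (2 ^ k * (s - t)) * hat (2 ^ (k + 1) * (x - s)) =
      hat (2 ^ k * (x - t)) := by
  obtain ⟨p, -, rfl⟩ := mem_grid.1 ht
  have h2 : (0 : ℝ) < 2 ^ k := by positivity
  have h3 : (0 : ℝ) < 2 ^ (k + 1) := by positivity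
  have key := sum_mul_hat_eq (N := 2 ^ (k + 1)) Nat.one_le_two_pow
    (h := fun y => hat ((y - 2 * p) / 2))
    (fun j _ s hs0 hs1 => by
      have := hat_affine_half ((j : ℤ) - 2 * p) hs0 hs1
      push_cast at this
      rw [show (j : ℝ) + s - 2 * p = j - 2 * p + s by ring,
        show (j : ℝ) + 1 - 2 * p = j - 2 * p + 1 by ring]
      exact this)
    (y := 2 ^ (k + 1) * x) (by positivity)
    (by push_cast; exact mul_le_of_le_one_right h3.le h1)
  rw [sum_grid]
  refine Eq.trans (Finset.sum_congr rfl fun m _ => ?_) (key.trans ?_)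
  · congr 2
    · rw [pow_succ]; field_simp
    · rw [mul_sub, mul_div_cancel₀ _ h3.ne']
  · congr 1
    rw [pow_succ]; field_simp

open Classical in
/-- The coordinate of a neighbour: a node of `D_{k+1}` is moved by `± 2^{-(k+1)}`, every other
point stays. -/
def shift (k : ℕ) (s : ℝ) (e : ℤˣ) : ℝ :=
  if s ∈ dyadic (k + 1) then s + ((e : ℤ) : ℝ) / 2 ^ (k + 1) else s

theorem shift_of_mem_grid {k : ℕ} {s : ℝ} (hs : s ∈ grid k) (e : ℤˣ) : shift k s e = s :=
  if_neg (not_mem_dyadic_succ_of_mem_grid hs)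

theorem abs_shift_sub_le (k : ℕ) (s : ℝ) (e : ℤˣ) : |s - shift k s e| ≤ 1 / 2 ^ (k + 1) := by
  unfold shift
  split_ifs
  · rw [sub_add_cancel_left, abs_neg, abs_div,
      abs_of_pos (show (0 : ℝ) < 2 ^ (k + 1) by positivity)]
    rcases Int.units_eq_one_or e with rfl | rfl <;> simp
  · rw [sub_self, abs_zero]; positivity

theorem shift_mem_grid {k : ℕ} {s : ℝ} (hs : s ∈ grid (k + 1)) (e : ℤˣ) : shift k s e ∈ grid k := by
  rcases mem_grid_succ.1 hs with h | h
  · rwa [shift_of_mem_grid h]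
  · rw [shift, if_pos h]
    obtain ⟨p, h1, h2, rfl⟩ := h
    rcases Int.units_eq_one_or e with rfl | rfl
    · refine mem_grid.2 ⟨p, h2, ?_⟩
      rw [pow_succ]; push_cast; field_simp; ring
    · refine mem_grid.2 ⟨p - 1, by omega, ?_⟩
      rw [pow_succ, Nat.cast_sub h1]; push_cast; field_simp; ring

theorem hat_int (a : ℤ) : hat a = if a = 0 then 1 else 0 := by
  split_ifs with h
  · simp [h, hat_eq_max]
  · exact hat_eq_zero (by exact_mod_cast Int.one_le_abs h)

theorem hat_int_sub_half (a : ℤ) :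
    hat (a - 1 / 2) = (if a = 0 then 1 / 2 else 0) + if a = 1 then 1 / 2 else 0 := by
  rcases le_or_gt 2 a with h | h
  · have : (2 : ℝ) ≤ a := by exact_mod_cast h
    rw [hat_eq_zero (le_trans (by linarith) (le_abs_self _)), if_neg (by omega), if_neg (by omega),
      add_zero]
  rcases le_or_gt a (-1) with h' | h'
  · have : (a : ℝ) ≤ -1 := by exact_mod_cast h'
    rw [hat_eq_zero (le_trans (by linarith) (neg_le_abs _)), if_neg (by omega), if_neg (by omega),
      add_zero]
  simp only [hat_eq_max]
  interval_cases a <;> norm_num [abs_of_nonneg, abs_of_nonpos]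

/-- The values of the hat functions of level `k` at the nodes of level `k + 1`: interpolation
averages over the two neighbours. -/
theorem hat_grid_succ {k : ℕ} {s t : ℝ} (hs : s ∈ grid (k + 1)) (ht : t ∈ grid k) :
    hat (2 ^ k * (s - t)) = ∑ e : ℤˣ, if shift k s e = t then (1 / 2 : ℝ) else 0 := by
  obtain ⟨m, -, rfl⟩ := mem_grid.1 ht
  have h2 : (2 : ℝ) ^ k ≠ 0 := by positivity
  rcases mem_grid_succ.1 hs with h | h
  · simp only [shift_of_mem_grid h]
    obtain ⟨p, -, rfl⟩ := mem_grid.1 h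
    have e : (2 : ℝ) ^ k * ((p : ℝ) / 2 ^ k - m / 2 ^ k) = ((p - m : ℤ) : ℝ) := by
      push_cast; field_simp
    rw [e, hat_int]
    simp only [div_left_inj' h2, sub_eq_zero, Nat.cast_inj]
    split_ifs <;> simp
  · have hU : (Finset.univ : Finset ℤˣ) = {1, -1} := rfl
    rw [hU, Finset.sum_pair (by decide)]
    simp only [shift, if_pos h]
    obtain ⟨p, -, -, rfl⟩ := h
    have e1 : (2 * (p : ℝ) - 1) / 2 ^ (k + 1) + (((1 : ℤˣ) : ℤ) : ℝ) / 2 ^ (k + 1) = p / 2 ^ k := by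
      rw [pow_succ]; push_cast; field_simp; ring
    have e2 : (2 * (p : ℝ) - 1) / 2 ^ (k + 1) + (((-1 : ℤˣ) : ℤ) : ℝ) / 2 ^ (k + 1) =
        (p - 1) / 2 ^ k := by
      rw [pow_succ]; push_cast; field_simp; ring
    have e3 : (2 : ℝ) ^ k * ((2 * (p : ℝ) - 1) / 2 ^ (k + 1) - m / 2 ^ k) =
        ((p - m : ℤ) : ℝ) - 1 / 2 := by
      rw [pow_succ]; push_cast; field_simp; ring
    have c1 : (p : ℝ) / 2 ^ k = m / 2 ^ k ↔ (p - m : ℤ) = 0 := by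
      rw [div_left_inj' h2, Nat.cast_inj, sub_eq_zero, Nat.cast_inj]
    have c2 : ((p : ℝ) - 1) / 2 ^ k = m / 2 ^ k ↔ (p - m : ℤ) = 1 := by
      rw [div_left_inj' h2, sub_eq_iff_eq_add, sub_eq_iff_eq_add, add_comm (m : ℝ)]
      norm_cast
    rw [e1, e2, e3, hat_int_sub_half]
    simp only [c1, c2]

/-- At most two hat functions of one level do not vanish at a given point. -/
theorem card_grid_hat_ne_zero_le (k : ℕ) (x : ℝ) :
    ((grid k).filter fun t => hat (2 ^ k * (x - t)) ≠ 0).card ≤ 2 := by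
  have h2 : (0 : ℝ) < 2 ^ k := by positivity
  have hsub : ((grid k).filter fun t => hat (2 ^ k * (x - t)) ≠ 0) ⊆
      ({⌊2 ^ k * x⌋, ⌊2 ^ k * x⌋ + 1} : Finset ℤ).image fun m : ℤ => (m : ℝ) / 2 ^ k := by
    intro t ht
    obtain ⟨ht, hne⟩ := Finset.mem_filter.1 ht
    obtain ⟨m, -, rfl⟩ := mem_grid.1 ht
    have h1 : |2 ^ k * x - m| < 1 := by
      by_contra h
      apply hne
      rw [mul_sub, mul_div_cancel₀ _ h2.ne']
      exact hat_eq_zero (not_lt.1 h)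
    rw [abs_lt] at h1
    refine Finset.mem_image.2 ⟨m, ?_, by simp⟩
    have ha := Int.floor_le ((2 : ℝ) ^ k * x)
    have hb := Int.lt_floor_add_one ((2 : ℝ) ^ k * x)
    have hc : (⌊2 ^ k * x⌋ : ℝ) < ((m : ℤ) : ℝ) + 1 := by push_cast; linarith
    have hd : ((m : ℤ) : ℝ) < (⌊2 ^ k * x⌋ : ℝ) + 2 := by push_cast; linarith
    have hc' : ⌊2 ^ k * x⌋ < (m : ℤ) + 1 := by exact_mod_cast hc
    have hd' : (m : ℤ) < ⌊2 ^ k * x⌋ + 2 := by exact_mod_cast hd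
    rw [Finset.mem_insert, Finset.mem_singleton]
    omega
  exact (Finset.card_le_card hsub).trans (Finset.card_image_le.trans Finset.card_le_two)

/-! ### Multilinear interpolation on dyadic grids -/

/-- The tensor product hat function of level `k` centred at `τ`. -/
def bump {n : ℕ} (k : ℕ) (τ x : Fin n → ℝ) : ℝ := ∏ i, hat (2 ^ k * (x i - τ i))

/-- The grid of level `k` in the cube `[0, 1]^n`. -/
def gridPi (n k : ℕ) : Finset (Fin n → ℝ) := Fintype.piFinset fun _ => grid k

/-- The multilinear interpolation of `v` on the grid of level `k`. -/
def interp {n : ℕ} (k : ℕ) (v : (Fin n → ℝ) → ℝ) (x : Fin n → ℝ) : ℝ :=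
  ∑ τ ∈ gridPi n k, v τ * bump k τ x

/-- The neighbour of `σ` in the direction `ε`, on the level of coordinates. -/
def shiftPi {n : ℕ} (k : ℕ) (σ : Fin n → ℝ) (ε : Fin n → ℤˣ) : Fin n → ℝ :=
  fun i => shift k (σ i) (ε i)

theorem mem_gridPi {n k : ℕ} {τ : Fin n → ℝ} : τ ∈ gridPi n k ↔ ∀ i, τ i ∈ grid k :=
  Fintype.mem_piFinset

theorem bump_nonneg {n : ℕ} (k : ℕ) (τ x : Fin n → ℝ) : 0 ≤ bump k τ x :=
  Finset.prod_nonneg fun _ _ => hat_nonneg _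

theorem bump_le_one {n : ℕ} (k : ℕ) (τ x : Fin n → ℝ) : bump k τ x ≤ 1 :=
  Finset.prod_le_one (fun _ _ => hat_nonneg _) fun _ _ => hat_le_one _

theorem sum_gridPi_bump {n : ℕ} (k : ℕ) {x : Fin n → ℝ} (hx : ∀ i, 0 ≤ x i ∧ x i ≤ 1) :
    ∑ τ ∈ gridPi n k, bump k τ x = 1 := by
  unfold bump gridPi
  rw [← Finset.prod_univ_sum (fun _ => grid k) fun i t => hat (2 ^ k * (x i - t))]
  exact Finset.prod_eq_one fun i _ => sum_grid_hat k (hx i).1 (hx i).2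

theorem sum_gridPi_succ_bump_mul_bump {n k : ℕ} {τ : Fin n → ℝ} (hτ : τ ∈ gridPi n k)
    {x : Fin n → ℝ} (hx : ∀ i, 0 ≤ x i ∧ x i ≤ 1) :
    ∑ σ ∈ gridPi n (k + 1), bump k τ σ * bump (k + 1) σ x = bump k τ x := by
  unfold bump gridPi
  simp only [← Finset.prod_mul_distrib]
  rw [← Finset.prod_univ_sum (fun _ => grid (k + 1))
    fun i s => hat (2 ^ k * (s - τ i)) * hat (2 ^ (k + 1) * (x i - s))]
  exact Finset.prod_congr rfl fun i _ =>
    sum_grid_succ_hat_mul_hat (mem_gridPi.1 hτ i) (hx i).1 (hx i).2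

theorem bump_grid_succ {n k : ℕ} {σ τ : Fin n → ℝ} (hσ : σ ∈ gridPi n (k + 1))
    (hτ : τ ∈ gridPi n k) :
    bump k τ σ = ∑ ε : Fin n → ℤˣ, if shiftPi k σ ε = τ then (1 / 2 : ℝ) ^ n else 0 := by
  unfold bump
  rw [Finset.prod_congr rfl fun i _ => hat_grid_succ (mem_gridPi.1 hσ i) (mem_gridPi.1 hτ i),
    Finset.prod_univ_sum, Fintype.piFinset_univ]
  refine Finset.sum_congr rfl fun ε _ => ?_
  rw [Finset.prod_ite_zero]
  simp [funext_iff, shiftPi]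

/-- At a node of level `k + 1`, the interpolation of level `k` is the average over the
neighbours. -/
theorem interp_grid_succ {n k : ℕ} (v : (Fin n → ℝ) → ℝ) {σ : Fin n → ℝ}
    (hσ : σ ∈ gridPi n (k + 1)) :
    interp k v σ = (1 / 2 : ℝ) ^ n * ∑ ε : Fin n → ℤˣ, v (shiftPi k σ ε) := by
  unfold interp
  rw [Finset.sum_congr rfl fun τ hτ => by rw [bump_grid_succ hσ hτ, Finset.mul_sum],
    Finset.sum_comm, Finset.mul_sum]
  refine Finset.sum_congr rfl fun ε _ => ?_
  have hmem : shiftPi k σ ε ∈ gridPi n k :=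
    mem_gridPi.2 fun i => shift_mem_grid (mem_gridPi.1 hσ i) _
  simp only [mul_ite, mul_zero]
  rw [Finset.sum_ite_eq, if_pos hmem, mul_comm]

/-- Interpolation on the finer grid reproduces the interpolation on the coarser one. -/
theorem interp_succ_interp {n k : ℕ} (v : (Fin n → ℝ) → ℝ) {x : Fin n → ℝ}
    (hx : ∀ i, 0 ≤ x i ∧ x i ≤ 1) : interp (k + 1) (interp k v) x = interp k v x := by
  conv_rhs => unfold interp
  unfold interp
  simp only [Finset.sum_mul]
  rw [Finset.sum_comm]
  refine Finset.sum_congr rfl fun τ hτ => ?_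
  rw [← sum_gridPi_succ_bump_mul_bump hτ hx, Finset.mul_sum]
  exact Finset.sum_congr rfl fun σ _ => mul_assoc _ _ _

/-- The increment of the interpolation from one level to the next, expanded in hat functions of
the finer level. -/
theorem interp_succ_sub_interp {n k : ℕ} (v : (Fin n → ℝ) → ℝ) {x : Fin n → ℝ}
    (hx : ∀ i, 0 ≤ x i ∧ x i ≤ 1) :
    interp (k + 1) v x - interp k v x = ∑ σ ∈ gridPi n (k + 1),
      ((1 / 2 : ℝ) ^ n * ∑ ε : Fin n → ℤˣ, (v σ - v (shiftPi k σ ε))) * bump (k + 1) σ x := by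
  rw [← interp_succ_interp (k := k) v hx]
  unfold interp
  rw [← Finset.sum_sub_distrib]
  refine Finset.sum_congr rfl fun σ hσ => ?_
  have h := interp_grid_succ v hσ
  unfold interp at h
  rw [h, Finset.sum_sub_distrib, ← sub_mul, mul_sub]
  congr 2
  rw [Finset.sum_const, Finset.card_univ, Fintype.card_fun, Fintype.card_fin,
    Fintype.card_units_int, nsmul_eq_mul, ← mul_assoc]
  push_cast
  rw [← mul_pow]
  norm_num

/-! ### Faber–Schauder sums of one level -/

/-- The coordinates of a point of the cube. -/
def coords {n : ℕ} (x : Cube n) : Fin n → ℝ := fun i => x.1 i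

/-- The coordinatewise retraction of `ℝ^n` onto the cube. -/
def toCube {n : ℕ} (y : Fin n → ℝ) : Cube n :=
  ⟨WithLp.toLp 2 fun i => max 0 (min 1 (y i)), fun _ =>
    ⟨le_max_left _ _, max_le zero_le_one (min_le_left _ _)⟩⟩

theorem coords_injective {n : ℕ} : Function.Injective (coords : Cube n → Fin n → ℝ) :=
  fun _ _ h => Subtype.ext (PiLp.ext fun i => congrFun h i)

theorem coords_toCube {n : ℕ} {y : Fin n → ℝ} (hy : ∀ i, 0 ≤ y i ∧ y i ≤ 1) :
    coords (toCube y) = y := by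
  funext i
  change max 0 (min 1 (y i)) = y i
  rw [min_eq_right (hy i).2, max_eq_right (hy i).1]

theorem toCube_coords {n : ℕ} (x : Cube n) : toCube (coords x) = x :=
  coords_injective (coords_toCube x.2)

theorem toCube_shiftPi {n k : ℕ} (τ : Cube n) (ε : Fin n → ℤˣ) :
    toCube (shiftPi k (coords τ) ε) = neighbour k τ ε :=
  toCube_coords (neighbour k τ ε)

theorem coords_mem_gridPi {n k : ℕ} {τ : Cube n} (h : τ ∈ dyadicNodes n k) :
    coords τ ∈ gridPi n k :=
  mem_gridPi.2 fun i => mem_grid_iff.2 (h.1 i)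

instance finite_dyadicNodes (n k : ℕ) : Finite {τ : Cube n // τ ∈ dyadicNodes n k} :=
  Finite.of_injective
    (fun τ => (⟨coords τ.1, coords_mem_gridPi τ.2⟩ : {σ // σ ∈ gridPi n k}))
    fun _ _ h => Subtype.ext (coords_injective (congrArg Subtype.val h))

instance fintype_dyadicNodes (n k : ℕ) : Fintype {τ : Cube n // τ ∈ dyadicNodes n k} :=
  Fintype.ofFinite _

open Classical in
/-- Sums over `D_k^n` are sums over the grid of level `k`, if the summand vanishes at the nodes
without coordinate in `D_k`. -/
theorem sum_dyadicNodes {n k : ℕ} {G : (Fin n → ℝ) → ℝ}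
    (hG : ∀ σ ∈ gridPi n k, (∀ i, σ i ∉ dyadic k) → G σ = 0) :
    ∑ τ : {τ : Cube n // τ ∈ dyadicNodes n k}, G (coords τ.1) = ∑ σ ∈ gridPi n k, G σ := by
  rw [← Finset.sum_filter_of_ne (s := gridPi n k) (p := fun σ => ∃ i, σ i ∈ dyadic k)
    fun σ hσ hne => by by_contra h; exact hne (hG σ hσ (not_exists.1 h))]
  refine Finset.sum_bij (fun τ _ => coords τ.1) (fun τ _ => ?_)
    (fun _ _ _ _ h => Subtype.ext (coords_injective h)) (fun σ hσ => ?_) fun _ _ => rfl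
  · exact Finset.mem_filter.2 ⟨coords_mem_gridPi τ.2, τ.2.2⟩
  · obtain ⟨h1, h2⟩ := Finset.mem_filter.1 hσ
    have h1' := mem_gridPi.1 h1
    have e : coords (toCube σ) = σ := coords_toCube fun i => grid_nonneg_le_one (h1' i)
    have e' : ∀ i, (toCube σ).1 i = σ i := congrFun e
    refine ⟨⟨toCube σ, fun i => ?_, ?_⟩, Finset.mem_univ _, e⟩
    · rw [e' i]; exact mem_grid_iff.1 (h1' i)
    · obtain ⟨i, hi⟩ := h2
      exact ⟨i, by rw [e' i]; exact hi⟩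

theorem faber_eq {n : ℕ} (γ : ℝ) (k : ℕ) (τ : {τ : Cube n // τ ∈ dyadicNodes n k}) (x : Cube n) :
    faber γ ⟨k, τ⟩ x = (2 : ℝ) ^ (-(γ * (k : ℝ))) * bump k (coords τ.1) (coords x) := rfl

theorem DiscMeasure.pair_eq_linearCombination {Y : Type*} (μ : DiscMeasure Y) (g : Y → ℝ) :
    μ.pair g = Finsupp.linearCombination ℝ g μ := rfl

theorem DiscMeasure.pair_sum_right {Y ι : Type*} (μ : DiscMeasure Y) (s : Finset ι)
    (g : ι → Y → ℝ) (b : ι → ℝ) :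
    μ.pair (fun y => ∑ i ∈ s, g i y * b i) = ∑ i ∈ s, μ.pair (g i) * b i := by
  unfold DiscMeasure.pair Finsupp.sum
  simp only [Finset.mul_sum, Finset.sum_mul]
  rw [Finset.sum_comm]
  exact Finset.sum_congr rfl fun _ _ => Finset.sum_congr rfl fun _ _ => (mul_assoc _ _ _).symm

/-- Fubini's theorem for finitely supported measures. -/
theorem DiscMeasure.pair_tensor {Y Z : Type*} (μ : DiscMeasure Y) (ν : DiscMeasure Z)
    (c : Y × Z → ℝ) : (μ.tensor ν).pair c = μ.pair fun y => ν.pair fun z => c (y, z) := by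
  rw [pair_eq_linearCombination, tensor]
  simp only [Finsupp.sum, map_sum, Finsupp.linearCombination_single, pair, smul_eq_mul,
    Finset.mul_sum, mul_assoc]

theorem pair_faberCoeff_zero {n : ℕ} (γ : ℝ) (τ : {τ : Cube n // τ ∈ dyadicNodes n 0})
    (u : Cube n → ℝ) : (faberCoeff γ ⟨0, τ⟩).pair u = u τ.1 := by
  rw [faberCoeff, DiscMeasure.pair_eq_linearCombination, Finsupp.linearCombination_single, one_smul]

theorem pair_faberCoeff_succ {n : ℕ} (γ : ℝ) (k : ℕ)
    (τ : {τ : Cube n // τ ∈ dyadicNodes n (k + 1)}) (u : Cube n → ℝ) :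
    (faberCoeff γ ⟨k + 1, τ⟩).pair u = (2 : ℝ) ^ (γ * ((k + 1 : ℕ) : ℝ)) *
      ((1 / 2 : ℝ) ^ n * ∑ ε : Fin n → ℤˣ, (u τ.1 - u (neighbour k τ.1 ε))) := by
  rw [faberCoeff, DiscMeasure.pair_eq_linearCombination, map_smul, map_sum]
  simp only [map_sub, Finsupp.linearCombination_single, one_smul]
  rw [Real.rpow_sub two_pos, smul_eq_mul, Real.rpow_natCast, one_div, inv_pow, div_eq_mul_inv,
    mul_assoc]

theorem rpow_mul_rpow_neg_two (a : ℝ) : (2 : ℝ) ^ a * (2 : ℝ) ^ (-a) = 1 := by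
  rw [← Real.rpow_add two_pos, add_neg_cancel, Real.rpow_zero]

theorem sum_faber_zero {n : ℕ} (hn : 1 ≤ n) (γ : ℝ) (u : Cube n → ℝ) (x : Cube n) :
    ∑ τ : {τ : Cube n // τ ∈ dyadicNodes n 0},
      (faberCoeff γ ⟨0, τ⟩).pair u * faber γ ⟨0, τ⟩ x =
      interp 0 (u ∘ toCube) (coords x) := by
  unfold interp
  rw [← sum_dyadicNodes]
  · refine Finset.sum_congr rfl fun τ _ => ?_
    rw [pair_faberCoeff_zero, faber_eq, Function.comp_apply, toCube_coords, Nat.cast_zero,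
      mul_zero, neg_zero, Real.rpow_zero, one_mul]
  · intro σ hσ h
    obtain ⟨j, hj, hi⟩ := mem_grid_iff.1 (mem_gridPi.1 hσ ⟨0, hn⟩)
    rw [Nat.le_zero.1 hj] at hi
    exact absurd hi (h _)

theorem sum_faber_succ {n : ℕ} (γ : ℝ) (k : ℕ) (u : Cube n → ℝ) (x : Cube n) :
    ∑ τ : {τ : Cube n // τ ∈ dyadicNodes n (k + 1)},
      (faberCoeff γ ⟨k + 1, τ⟩).pair u * faber γ ⟨k + 1, τ⟩ x =
      interp (k + 1) (u ∘ toCube) (coords x) - interp k (u ∘ toCube) (coords x) := by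
  rw [interp_succ_sub_interp (x := coords x) _ x.2, ← sum_dyadicNodes]
  · refine Finset.sum_congr rfl fun τ _ => ?_
    rw [pair_faberCoeff_succ, faber_eq, mul_mul_mul_comm, rpow_mul_rpow_neg_two, one_mul]
    simp only [Function.comp_apply, toCube_coords, toCube_shiftPi]
  · intro σ _ h
    have hs : ∀ ε, shiftPi k σ ε = σ := fun ε => funext fun i => if_neg (h i)
    simp [hs]

/-- The partial sum of the Faber–Schauder series over the levels up to `K` interpolates on the grid
of level `K`. -/
theorem sum_faber_range {n : ℕ} (hn : 1 ≤ n) (γ : ℝ) (K : ℕ) (u : Cube n → ℝ) (x : Cube n) :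
    ∑ k ∈ Finset.range (K + 1), ∑ τ : {τ : Cube n // τ ∈ dyadicNodes n k},
      (faberCoeff γ ⟨k, τ⟩).pair u * faber γ ⟨k, τ⟩ x = interp K (u ∘ toCube) (coords x) := by
  induction K with
  | zero => rw [zero_add, Finset.sum_range_one, sum_faber_zero hn]
  | succ K ih => rw [Finset.sum_range_succ, ih, sum_faber_succ, add_sub_cancel]

/-- The nodes of the levels up to `K`. -/
def nodesUpTo (n K : ℕ) : Finset (FaberIndex n) :=
  (Finset.range (K + 1)).sigma fun _ => Finset.univ

theorem mem_nodesUpTo {n K : ℕ} {τ : FaberIndex n} : τ ∈ nodesUpTo n K ↔ τ.1 ≤ K := by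
  simp [nodesUpTo]

theorem sum_nodesUpTo {n : ℕ} (hn : 1 ≤ n) (γ : ℝ) (K : ℕ) (u : Cube n → ℝ) (x : Cube n) :
    ∑ τ ∈ nodesUpTo n K, (faberCoeff γ τ).pair u * faber γ τ x =
      interp K (u ∘ toCube) (coords x) := by
  rw [← sum_faber_range hn γ K u x, nodesUpTo, Finset.sum_sigma]

/-- The partial sums of the double series are the iterated interpolations. -/
theorem sum_nodesUpTo_product {n : ℕ} (hn : 1 ≤ n) (γ : ℝ) (K : ℕ) (c : Cube n × Cube n → ℝ)
    (x x' : Cube n) :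
    ∑ q ∈ nodesUpTo n K ×ˢ nodesUpTo n K,
      ((faberCoeff γ q.1).tensor (faberCoeff γ q.2)).pair c *
        (faber γ q.1 x * faber γ q.2 x') =
      ∑ σ ∈ gridPi n K, ∑ σ' ∈ gridPi n K,
        c (toCube σ, toCube σ') * (bump K σ (coords x) * bump K σ' (coords x')) := by
  have h1 : ∀ τ : FaberIndex n, ∑ t ∈ nodesUpTo n K,
      ((faberCoeff γ τ).tensor (faberCoeff γ t)).pair c * (faber γ τ x * faber γ t x') =
      (faberCoeff γ τ).pair
        (fun y => interp K ((fun z => c (y, z)) ∘ toCube) (coords x')) * faber γ τ x := by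
    intro τ
    simp only [← sum_nodesUpTo hn γ, DiscMeasure.pair_sum_right, DiscMeasure.pair_tensor,
      Finset.sum_mul]
    exact Finset.sum_congr rfl fun t _ => by ring
  rw [Finset.sum_product, Finset.sum_congr rfl fun τ _ => h1 τ, sum_nodesUpTo hn]
  refine Finset.sum_congr rfl fun σ _ => ?_
  rw [Function.comp_apply, interp, Finset.sum_mul]
  exact Finset.sum_congr rfl fun σ' _ => by rw [Function.comp_apply]; ring

/-! ### Convergence in Lipschitz norms -/

section LipConvergence

variable {M : Type*} [MetricSpace M]

theorem LipSpace.sum_apply {ι : Type*} (S : Finset ι) (f : ι → LipSpace M) (x : M) :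
    (∑ q ∈ S, f q) x = ∑ q ∈ S, f q x := by
  classical
  induction S using Finset.induction_on with
  | empty => rfl
  | insert a s ha ih => rw [Finset.sum_insert ha, Finset.sum_insert ha, LipSpace.add_apply, ih]

/-- A series whose finite partial sums form a Cauchy net in the Lipschitz norm converges
unconditionally to any function that is the pointwise limit of one exhausting sequence of partial
sums: the norm is lower semicontinuous for pointwise convergence. -/
theorem LipSpace.hasSum_of_cauchySeq {ι : Type*} {f : ι → LipSpace M} {c : LipSpace M}
    (hf : CauchySeq fun S : Finset ι => ∑ q ∈ S, f q) {T : ℕ → Finset ι}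
    (hT : Tendsto T atTop atTop)
    (hc : ∀ x, Tendsto (fun N => ∑ q ∈ T N, f q x) atTop (𝓝 (c x))) : HasSum f c := by
  classical
  rw [HasSum, SummationFilter.unconditional_filter, Metric.tendsto_atTop]
  intro ε hε
  obtain ⟨S₀, hS₀⟩ := Metric.cauchySeq_iff.1 hf (ε / 2) (half_pos hε)
  refine ⟨S₀, fun S hS => ?_⟩
  rw [dist_eq_norm]
  refine lt_of_le_of_lt ?_ (half_lt_self hε)
  have key : ∀ᶠ N in atTop, ‖∑ q ∈ S, f q - ∑ q ∈ T N, f q‖ ≤ ε / 2 := by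
    filter_upwards [hT.eventually_ge_atTop S₀] with N hN
    rw [← dist_eq_norm]
    exact (hS₀ S hS (T N) hN).le
  have hsub : ∀ (g h : LipSpace M) (x : M), (g - h) x = g x - h x := fun _ _ _ => rfl
  have lim : ∀ x, Tendsto (fun N => (∑ q ∈ S, f q - ∑ q ∈ T N, f q) x) atTop
      (𝓝 ((∑ q ∈ S, f q - c) x)) := by
    intro x
    simp only [hsub, LipSpace.sum_apply (T _)]
    exact (hc x).const_sub _
  refine LipSpace.norm_le_of (half_pos hε).le (fun x => ?_) fun x y => ?_
  · exact le_of_tendsto (lim x).abs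
      (key.mono fun N hN => (LipSpace.abs_apply_le_norm _ x).trans hN)
  · exact le_of_tendsto (((lim x).sub (lim y)).abs.div_const _)
      (key.mono fun N hN => (LipSpace.quot_le_norm _ x y).trans hN)

/-- A bounded function that is Hölder continuous of an exponent larger than `1` is Lipschitz. -/
theorem mem_lipSubmodule_of_holder {f : M → ℝ} {B A θ : ℝ} (hB : ∀ x, |f x| ≤ B) (hθ : 1 < θ)
    (hA : 0 ≤ A) (h : ∀ x y, |f x - f y| ≤ A * dist x y ^ θ) : f ∈ lipSubmodule M := by
  refine ⟨⟨B, hB⟩, A + 2 * B, fun x y => ?_⟩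
  have hB0 : 0 ≤ B := (abs_nonneg _).trans (hB x)
  have hd : 0 ≤ dist x y := dist_nonneg
  rcases le_total (dist x y) 1 with h1 | h1
  · refine (h x y).trans ?_
    have : dist x y ^ θ ≤ dist x y := by
      simpa using Real.rpow_le_rpow_of_exponent_ge_of_imp hd h1 hθ.le
        (fun _ h => absurd h (by linarith))
    nlinarith
  · refine (abs_sub _ _).trans ?_
    nlinarith [hB x, hB y]

theorem mem_littleLip_of_holder {f : LipSpace M} {A θ : ℝ} (hθ : 1 < θ) (hA : 0 ≤ A)
    (h : ∀ x y, |f x - f y| ≤ A * dist x y ^ θ) : f ∈ littleLip M := by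
  intro ε hε
  have hA1 : 0 < A + 1 := by linarith
  have hθ' : 0 < θ - 1 := by linarith
  refine ⟨(ε / (A + 1)) ^ (θ - 1)⁻¹, Real.rpow_pos_of_pos (div_pos hε hA1) _, fun x y h0 h1 => ?_⟩
  rw [div_le_iff₀ h0]
  have h2 : dist x y ^ (θ - 1) ≤ ε / (A + 1) :=
    (Real.rpow_le_rpow h0.le h1.le hθ'.le).trans_eq
      (Real.rpow_inv_rpow (div_pos hε hA1).le hθ'.ne')
  have h3 : dist x y ^ θ = dist x y ^ (θ - 1) * dist x y := by
    rw [← Real.rpow_add_one h0.ne', sub_add_cancel]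
  calc |f x - f y| ≤ A * dist x y ^ θ := h x y
    _ = A * dist x y ^ (θ - 1) * dist x y := by rw [h3, mul_assoc]
    _ ≤ (A + 1) * (ε / (A + 1)) * dist x y := by gcongr; linarith
    _ = ε * dist x y := by rw [mul_div_cancel₀ _ hA1.ne']

end LipConvergence

/-! ### Size and oscillation of the Faber–Schauder functions -/

theorem abs_prod_sub_prod_le {ι : Type*} (s : Finset ι) {a b : ι → ℝ} (ha0 : ∀ i, 0 ≤ a i)
    (ha : ∀ i, a i ≤ 1) (hb0 : ∀ i, 0 ≤ b i) (hb : ∀ i, b i ≤ 1) :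
    |∏ i ∈ s, a i - ∏ i ∈ s, b i| ≤ ∑ i ∈ s, |a i - b i| := by
  classical
  induction s using Finset.induction_on with
  | empty => simp
  | insert j s hj ih =>
    rw [Finset.prod_insert hj, Finset.prod_insert hj, Finset.sum_insert hj]
    have h1 : |∏ i ∈ s, a i| ≤ 1 := by
      rw [abs_of_nonneg (Finset.prod_nonneg fun i _ => ha0 i)]
      exact Finset.prod_le_one (fun i _ => ha0 i) fun i _ => ha i
    have h2 : |b j| ≤ 1 := by rw [abs_of_nonneg (hb0 j)]; exact hb j
    calc |a j * ∏ i ∈ s, a i - b j * ∏ i ∈ s, b i|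
        = |(a j - b j) * ∏ i ∈ s, a i + b j * (∏ i ∈ s, a i - ∏ i ∈ s, b i)| := by
          congr 1; ring
      _ ≤ |a j - b j| * |∏ i ∈ s, a i| + |b j| * |∏ i ∈ s, a i - ∏ i ∈ s, b i| := by
          rw [← abs_mul, ← abs_mul]; exact abs_add_le _ _
      _ ≤ |a j - b j| * 1 + 1 * ∑ i ∈ s, |a i - b i| := by gcongr
      _ = _ := by ring

theorem abs_coords_sub_le_dist {n : ℕ} (x y : Cube n) (i : Fin n) :
    |coords x i - coords y i| ≤ dist x y := by
  rw [Subtype.dist_eq, dist_eq_norm]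
  exact PiLp.norm_apply_le (x.1 - y.1) i

theorem dist_le_of_abs_coords_sub_le {n : ℕ} {x y : Cube n} {δ : ℝ} (hδ : 0 ≤ δ)
    (h : ∀ i, |coords x i - coords y i| ≤ δ) : dist x y ≤ n * δ := by
  rw [Subtype.dist_eq, EuclideanSpace.dist_eq]
  refine Real.sqrt_le_iff.2 ⟨by positivity, ?_⟩
  have hsum : ∑ i, dist (x.1 i) (y.1 i) ^ 2 ≤ ∑ _i : Fin n, δ ^ 2 :=
    Finset.sum_le_sum fun i _ => pow_le_pow_left₀ dist_nonneg (h i) 2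
  refine hsum.trans ?_
  rw [Finset.sum_const, Finset.card_univ, Fintype.card_fin, nsmul_eq_mul, mul_pow]
  have hn : (n : ℝ) ≤ (n : ℝ) ^ 2 := by exact_mod_cast Nat.le_self_pow two_ne_zero n
  gcongr

theorem dist_cube_le {n : ℕ} (x y : Cube n) : dist x y ≤ n := by
  refine (dist_le_of_abs_coords_sub_le zero_le_one fun i => ?_).trans_eq (mul_one _)
  have hx := x.2 i
  have hy := y.2 i
  change |x.1 i - y.1 i| ≤ 1
  rw [abs_le]
  constructor <;> linarith

theorem abs_bump_sub_bump_le {n : ℕ} (k : ℕ) (τ : Fin n → ℝ) (x y : Cube n) :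
    |bump k τ (coords x) - bump k τ (coords y)| ≤ n * (2 ^ k * dist x y) := by
  refine (abs_prod_sub_prod_le _ (fun _ => hat_nonneg _) (fun _ => hat_le_one _)
    (fun _ => hat_nonneg _) (fun _ => hat_le_one _)).trans ?_
  have hi : ∀ i ∈ Finset.univ,
      |hat (2 ^ k * (coords x i - τ i)) - hat (2 ^ k * (coords y i - τ i))| ≤ 2 ^ k * dist x y := by
    intro i _
    refine (abs_hat_sub_hat_le _ _).trans ?_
    rw [← mul_sub, sub_sub_sub_cancel_right, abs_mul, abs_of_pos (by positivity)]
    exact mul_le_mul_of_nonneg_left (abs_coords_sub_le_dist x y i) (by positivity)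
  refine (Finset.sum_le_card_nsmul _ _ _ hi).trans_eq ?_
  rw [Finset.card_univ, Fintype.card_fin, nsmul_eq_mul]

theorem card_gridPi_bump_ne_zero_le {n : ℕ} (k : ℕ) (x : Fin n → ℝ) :
    ((gridPi n k).filter fun τ => bump k τ x ≠ 0).card ≤ 2 ^ n := by
  have hsub : ((gridPi n k).filter fun τ => bump k τ x ≠ 0) ⊆
      Fintype.piFinset fun i => (grid k).filter fun t => hat (2 ^ k * (x i - t)) ≠ 0 := by
    intro τ hτ
    obtain ⟨h1, h2⟩ := Finset.mem_filter.1 hτ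
    rw [bump, Finset.prod_ne_zero_iff] at h2
    exact Fintype.mem_piFinset.2 fun i =>
      Finset.mem_filter.2 ⟨mem_gridPi.1 h1 i, h2 i (Finset.mem_univ i)⟩
  refine (Finset.card_le_card hsub).trans ?_
  rw [Fintype.card_piFinset]
  refine (Finset.prod_le_pow_card _ _ 2 fun i _ => card_grid_hat_ne_zero_le k (x i)).trans_eq ?_
  rw [Finset.card_univ, Fintype.card_fin]

/-- The total oscillation of the hat functions of one level. At most `2 ^ (n + 1)` terms do not
vanish, and each is controlled by interpolating between the trivial and the Lipschitz bound. -/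
theorem sum_abs_bump_sub_le {n : ℕ} (hn : 1 ≤ n) {γ : ℝ} (hγ0 : 0 < γ) (hγ1 : γ ≤ 1) (k : ℕ)
    (x y : Cube n) :
    ∑ τ ∈ gridPi n k, |bump k τ (coords x) - bump k τ (coords y)| ≤
      2 ^ (n + 1) * n * (2 ^ k * dist x y) ^ γ := by
  classical
  have hn' : (1 : ℝ) ≤ n := by exact_mod_cast hn
  have hd : 0 ≤ 2 ^ k * dist x y := by positivity
  have hterm : ∀ τ, |bump k τ (coords x) - bump k τ (coords y)| ≤ n * (2 ^ k * dist x y) ^ γ := by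
    intro τ
    rcases le_total (2 ^ k * dist x y) 1 with h | h
    · refine (abs_bump_sub_bump_le k τ x y).trans (mul_le_mul_of_nonneg_left ?_ (by positivity))
      simpa using Real.rpow_le_rpow_of_exponent_ge_of_imp hd h hγ1
        (fun _ h => absurd h one_ne_zero)
    · have h1 : |bump k τ (coords x) - bump k τ (coords y)| ≤ 1 := by
        have := bump_nonneg k τ (coords x)
        have := bump_nonneg k τ (coords y)
        have := bump_le_one k τ (coords x)
        have := bump_le_one k τ (coords y)
        rw [abs_le]; constructor <;> linarith
      exact h1.trans (one_le_mul_of_one_le_of_one_le hn' (Real.one_le_rpow h hγ0.le))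
  set A := (gridPi n k).filter fun τ => bump k τ (coords x) ≠ 0
  set B := (gridPi n k).filter fun τ => bump k τ (coords y) ≠ 0
  have hsub : A ∪ B ⊆ gridPi n k :=
    Finset.union_subset (Finset.filter_subset _ _) (Finset.filter_subset _ _)
  rw [← Finset.sum_subset hsub]
  · have hcard : ((A ∪ B).card : ℝ) ≤ 2 ^ (n + 1) := by
      have := (Finset.card_union_le A B).trans (add_le_add
        (card_gridPi_bump_ne_zero_le k (coords x)) (card_gridPi_bump_ne_zero_le k (coords y)))
      rw [← two_mul, ← pow_succ'] at this
      exact_mod_cast this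
    refine (Finset.sum_le_card_nsmul _ _ _ fun τ _ => hterm τ).trans ?_
    rw [nsmul_eq_mul, mul_assoc]
    exact mul_le_mul_of_nonneg_right hcard (by positivity)
  · intro τ hτ hAB
    rw [Finset.mem_union, not_or, Finset.mem_filter, Finset.mem_filter, not_and_not_right,
      not_and_not_right] at hAB
    rw [hAB.1 hτ, hAB.2 hτ, sub_zero, abs_zero]

theorem sum_dyadicNodes_le {n k : ℕ} {G : (Fin n → ℝ) → ℝ} (hG : ∀ σ, 0 ≤ G σ) :
    ∑ τ : {τ : Cube n // τ ∈ dyadicNodes n k}, G (coords τ.1) ≤ ∑ σ ∈ gridPi n k, G σ := by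
  classical
  rw [← Finset.sum_image (f := G) (s := Finset.univ)
    (g := fun τ : {τ : Cube n // τ ∈ dyadicNodes n k} => coords τ.1)
    fun _ _ _ _ h => Subtype.ext (coords_injective h)]
  refine Finset.sum_le_sum_of_subset_of_nonneg (fun σ hσ => ?_) fun σ _ _ => hG σ
  obtain ⟨τ, -, rfl⟩ := Finset.mem_image.1 hσ
  exact coords_mem_gridPi τ.2

theorem sum_abs_faber_le {n : ℕ} (γ : ℝ) (k : ℕ) (x : Cube n) :
    ∑ τ : {τ : Cube n // τ ∈ dyadicNodes n k}, |faber γ ⟨k, τ⟩ x| ≤ (2 : ℝ) ^ (-(γ * (k : ℝ))) := by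
  simp only [faber_eq, abs_mul, ← Finset.mul_sum, abs_of_nonneg (bump_nonneg _ _ _)]
  rw [abs_of_pos (Real.rpow_pos_of_pos two_pos _)]
  refine mul_le_of_le_one_right (Real.rpow_pos_of_pos two_pos _).le ?_
  exact (sum_dyadicNodes_le fun σ => bump_nonneg k σ (coords x)).trans_eq
    (sum_gridPi_bump k (x := coords x) x.2)

theorem sum_abs_faber_sub_le {n : ℕ} (hn : 1 ≤ n) {γ : ℝ} (hγ0 : 0 < γ) (hγ1 : γ ≤ 1) (k : ℕ)
    (x y : Cube n) :
    ∑ τ : {τ : Cube n // τ ∈ dyadicNodes n k}, |faber γ ⟨k, τ⟩ x - faber γ ⟨k, τ⟩ y| ≤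
      2 ^ (n + 1) * n * dist x y ^ γ := by
  simp only [faber_eq, ← mul_sub, abs_mul, ← Finset.mul_sum]
  have hpos : (0 : ℝ) < (2 : ℝ) ^ (-(γ * (k : ℝ))) := Real.rpow_pos_of_pos two_pos _
  rw [abs_of_pos hpos]
  have h := (sum_dyadicNodes_le (k := k) fun σ =>
    abs_nonneg (bump k σ (coords x) - bump k σ (coords y))).trans
    (sum_abs_bump_sub_le hn hγ0 hγ1 k x y)
  refine (mul_le_mul_of_nonneg_left h hpos.le).trans_eq ?_
  have e : (2 : ℝ) ^ (-(γ * (k : ℝ))) * ((2 : ℝ) ^ k) ^ γ = 1 := by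
    rw [← Real.rpow_natCast, ← Real.rpow_mul two_pos.le, mul_comm (k : ℝ), mul_comm,
      rpow_mul_rpow_neg_two]
  rw [Real.mul_rpow (by positivity) dist_nonneg]
  linear_combination (2 ^ (n + 1) * n * dist x y ^ γ) * e

/-! ### Hölder continuity of the kernel -/

theorem abs_rpow_sub_rpow_le {a b α : ℝ} (ha : 0 ≤ a) (hb : 0 ≤ b) (h0 : 0 ≤ α) (h1 : α ≤ 1) :
    |a ^ α - b ^ α| ≤ |a - b| ^ α := by
  wlog hab : b ≤ a generalizing a b
  · rw [abs_sub_comm, abs_sub_comm a]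
    exact this hb ha (le_of_not_ge hab)
  rw [abs_of_nonneg (sub_nonneg.2 (Real.rpow_le_rpow hb hab h0)), abs_of_nonneg (sub_nonneg.2 hab),
    sub_le_iff_le_add]
  simpa using Real.rpow_add_le_add_rpow (sub_nonneg.2 hab) hb h0 h1

theorem abs_exp_sub_exp_le {s t : ℝ} (hs : s ≤ 0) (ht : t ≤ 0) :
    |Real.exp s - Real.exp t| ≤ |s - t| := by
  wlog hst : t ≤ s generalizing s t
  · rw [abs_sub_comm, abs_sub_comm s]
    exact this ht hs (le_of_not_ge hst)
  rw [abs_of_nonneg (sub_nonneg.2 (Real.exp_le_exp.2 hst)), abs_of_nonneg (sub_nonneg.2 hst)]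
  have h1 := Real.add_one_le_exp (t - s)
  have h2 := Real.exp_le_one_iff.2 hs
  have h3 : Real.exp t = Real.exp s * Real.exp (t - s) := by rw [← Real.exp_add]; ring_nf
  have h4 := Real.exp_pos s
  rw [h3]
  nlinarith

theorem expKernel_nonneg {n : ℕ} {α : ℝ} (p : Cube n × Cube n) : 0 ≤ expKernel n α p :=
  (Real.exp_pos _).le

theorem abs_expKernel_le_one {n : ℕ} {α : ℝ} (p : Cube n × Cube n) : |expKernel n α p| ≤ 1 := by
  rw [abs_of_nonneg (expKernel_nonneg p)]
  refine Real.exp_le_one_iff.2 (neg_nonpos.2 ?_)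
  positivity

/-- The kernel is Hölder continuous of exponent `α`: with `a = ‖x - x'‖` and `b = ‖y - y'‖`,
`a ^ (2α) - b ^ (2α) = (a ^ α - b ^ α) (a ^ α + b ^ α)`, where the second factor is bounded on the
cube. -/
theorem abs_expKernel_sub_le {n : ℕ} (hn : 1 ≤ n) {α : ℝ} (h0 : 0 ≤ α) (h1 : α ≤ 1)
    (p q : Cube n × Cube n) :
    |expKernel n α p - expKernel n α q| ≤ n * (dist p.1 q.1 + dist p.2 q.2) ^ α := by
  have hn' : (1 : ℝ) ≤ n := by exact_mod_cast hn
  have hpow : ∀ z w : Cube n, dist z w ^ α ≤ n := fun z w =>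
    calc dist z w ^ α ≤ (n : ℝ) ^ α := Real.rpow_le_rpow dist_nonneg (dist_cube_le z w) h0
      _ ≤ (n : ℝ) ^ (1 : ℝ) := Real.rpow_le_rpow_of_exponent_le hn' h1
      _ = n := Real.rpow_one _
  have hexp : ∀ r : Cube n × Cube n,
      expKernel n α r = Real.exp (-((dist r.1 r.2 ^ α) ^ 2 / 2)) := by
    intro r
    rw [expKernel, ← dist_eq_norm, ← Subtype.dist_eq, ← Real.rpow_mul_natCast dist_nonneg,
      Nat.cast_two, mul_comm]
  set u := dist p.1 p.2 ^ α with hu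
  set v := dist q.1 q.2 ^ α with hv
  have hu0 : 0 ≤ u := Real.rpow_nonneg dist_nonneg _
  have hv0 : 0 ≤ v := Real.rpow_nonneg dist_nonneg _
  rw [hexp, hexp, ← hu, ← hv]
  refine (abs_exp_sub_exp_le (by linarith [sq_nonneg u]) (by linarith [sq_nonneg v])).trans ?_
  have huv : |u - v| ≤ (dist p.1 q.1 + dist p.2 q.2) ^ α := by
    refine (abs_rpow_sub_rpow_le dist_nonneg dist_nonneg h0 h1).trans ?_
    refine Real.rpow_le_rpow (abs_nonneg _) ?_ h0
    rw [← Real.dist_eq]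
    exact dist_dist_dist_le _ _ _ _
  calc |-(u ^ 2 / 2) - -(v ^ 2 / 2)| = |(u + v) / 2 * (v - u)| := by congr 1; ring
    _ = (u + v) / 2 * |u - v| := by
        rw [abs_mul, abs_of_nonneg (by positivity), abs_sub_comm v]
    _ ≤ n * (dist p.1 q.1 + dist p.2 q.2) ^ α := by
        have := hpow p.1 p.2
        have := hpow q.1 q.2
        gcongr
        linarith

/-! ### Decay of the coefficients -/

theorem dist_neighbour_le {n : ℕ} (k : ℕ) (τ : Cube n) (ε : Fin n → ℤˣ) :
    dist τ (neighbour k τ ε) ≤ n * (1 / 2 ^ (k + 1)) :=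
  dist_le_of_abs_coords_sub_le (by positivity) fun i => abs_shift_sub_le k (coords τ i) (ε i)

/-- A coefficient functional of level `k + 1` applied to a function whose differences at
neighbouring nodes are bounded by `B`. -/
theorem abs_pair_faberCoeff_succ_le {n : ℕ} (γ : ℝ) (k : ℕ)
    (τ : {τ : Cube n // τ ∈ dyadicNodes n (k + 1)}) {u : Cube n → ℝ} {B : ℝ}
    (hB : ∀ ε, |u τ.1 - u (neighbour k τ.1 ε)| ≤ B) :
    |(faberCoeff γ ⟨k + 1, τ⟩).pair u| ≤ (2 : ℝ) ^ (γ * ((k + 1 : ℕ) : ℝ)) * B := by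
  rw [pair_faberCoeff_succ, abs_mul, abs_mul, abs_of_pos (Real.rpow_pos_of_pos two_pos _),
    abs_of_pos (show (0 : ℝ) < (1 / 2) ^ n by positivity)]
  gcongr
  have h : |∑ ε : Fin n → ℤˣ, (u τ.1 - u (neighbour k τ.1 ε))| ≤ 2 ^ n * B := by
    refine (Finset.abs_sum_le_sum_abs _ _).trans
      ((Finset.sum_le_card_nsmul _ _ _ fun ε _ => hB ε).trans_eq ?_)
    rw [Finset.card_univ, Fintype.card_fun, Fintype.card_fin, Fintype.card_units_int, nsmul_eq_mul]
    push_cast; rfl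
  calc (1 / 2 : ℝ) ^ n * |∑ ε : Fin n → ℤˣ, (u τ.1 - u (neighbour k τ.1 ε))|
      ≤ (1 / 2 : ℝ) ^ n * (2 ^ n * B) := by gcongr
    _ = B := by rw [← mul_assoc, ← mul_pow]; norm_num

theorem abs_pair_faberCoeff_le {n : ℕ} (γ : ℝ) (τ : FaberIndex n) {u : Cube n → ℝ} {B : ℝ}
    (hB : ∀ y, |u y| ≤ B) : |(faberCoeff γ τ).pair u| ≤ (2 : ℝ) ^ (γ * (τ.1 : ℝ)) * (2 * B) := by
  obtain ⟨k, τ⟩ := τ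
  cases k with
  | zero =>
    rw [pair_faberCoeff_zero, Nat.cast_zero, mul_zero, Real.rpow_zero, one_mul]
    linarith [hB τ.1, (abs_nonneg _).trans (hB τ.1)]
  | succ k =>
    refine abs_pair_faberCoeff_succ_le γ k τ fun ε => (abs_sub _ _).trans ?_
    linarith [hB τ.1, hB (neighbour k τ.1 ε)]

theorem abs_pair_faberCoeff_le_of_holder {n : ℕ} (hn : 1 ≤ n) (γ : ℝ) {α : ℝ} (h0 : 0 ≤ α)
    (h1 : α ≤ 1) (τ : FaberIndex n) {u : Cube n → ℝ} {A : ℝ} (hB : ∀ y, |u y| ≤ A)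
    (hA : ∀ y z, |u y - u z| ≤ A * dist y z ^ α) :
    |(faberCoeff γ τ).pair u| ≤
      (2 : ℝ) ^ (γ * (τ.1 : ℝ)) * (n * A * (2 : ℝ) ^ (-(α * (τ.1 : ℝ)))) := by
  have hn' : (1 : ℝ) ≤ n := by exact_mod_cast hn
  obtain ⟨k, τ⟩ := τ
  have hA0 : 0 ≤ A := (abs_nonneg _).trans (hB τ.1)
  cases k with
  | zero =>
    rw [pair_faberCoeff_zero, Nat.cast_zero, mul_zero, mul_zero, neg_zero, Real.rpow_zero, one_mul,
      mul_one]
    exact (hB _).trans (le_mul_of_one_le_left hA0 hn')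
  | succ k =>
    refine abs_pair_faberCoeff_succ_le γ k τ fun ε => (hA _ _).trans ?_
    have hpow : dist τ.1 (neighbour k τ.1 ε) ^ α ≤
        n * (2 : ℝ) ^ (-(α * ((k + 1 : ℕ) : ℝ))) := by
      refine (Real.rpow_le_rpow dist_nonneg (dist_neighbour_le k τ.1 ε) h0).trans ?_
      rw [Real.mul_rpow (by positivity) (by positivity)]
      have e1 : (1 / 2 ^ (k + 1) : ℝ) ^ α = (2 : ℝ) ^ (-(α * ((k + 1 : ℕ) : ℝ))) := by
        rw [one_div, ← Real.rpow_natCast, ← Real.rpow_neg two_pos.le, ← Real.rpow_mul two_pos.le]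
        congr 1; ring
      have e2 : (n : ℝ) ^ α ≤ n :=
        (Real.rpow_le_rpow_of_exponent_le hn' h1).trans_eq (Real.rpow_one _)
      rw [e1]
      gcongr
    calc A * dist τ.1 (neighbour k τ.1 ε) ^ α
        ≤ A * (n * (2 : ℝ) ^ (-(α * ((k + 1 : ℕ) : ℝ)))) := by gcongr
      _ = _ := by ring

theorem DiscMeasure.pair_sub {Y : Type*} (μ : DiscMeasure Y) (f g : Y → ℝ) :
    μ.pair f - μ.pair g = μ.pair fun y => f y - g y := by
  unfold DiscMeasure.pair Finsupp.sum
  rw [← Finset.sum_sub_distrib]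
  exact Finset.sum_congr rfl fun _ _ => (mul_sub _ _ _).symm

theorem DiscMeasure.pair_pair_comm {Y Z : Type*} (μ : DiscMeasure Y) (ν : DiscMeasure Z)
    (c : Y × Z → ℝ) :
    (μ.pair fun y => ν.pair fun z => c (y, z)) = ν.pair fun z => μ.pair fun y => c (y, z) := by
  unfold DiscMeasure.pair Finsupp.sum
  simp only [Finset.mul_sum]
  rw [Finset.sum_comm]
  exact Finset.sum_congr rfl fun _ _ => Finset.sum_congr rfl fun _ _ => mul_left_comm _ _ _

/-- A double coefficient of a function that is Hölder continuous in its first variable decays with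
the level of the first node. -/
theorem abs_pair_pair_le_of_holder {n : ℕ} (hn : 1 ≤ n) (γ : ℝ) {α : ℝ} (h0 : 0 ≤ α) (h1 : α ≤ 1)
    (τ t : FaberIndex n) (c : Cube n × Cube n → ℝ) (hc1 : ∀ p, |c p| ≤ 1)
    (hc : ∀ y w z, |c (y, z) - c (w, z)| ≤ n * dist y w ^ α) :
    |(faberCoeff γ τ).pair fun y => (faberCoeff γ t).pair fun z => c (y, z)| ≤
      2 * n ^ 2 * ((2 : ℝ) ^ (γ * (τ.1 : ℝ)) * (2 : ℝ) ^ (γ * (t.1 : ℝ))) *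
        (2 : ℝ) ^ (-(α * (τ.1 : ℝ))) := by
  have hn' : (1 : ℝ) ≤ n := by exact_mod_cast hn
  refine (abs_pair_faberCoeff_le_of_holder hn γ h0 h1 τ
    (A := (2 : ℝ) ^ (γ * (t.1 : ℝ)) * (2 * n)) (fun y => ?_) fun y w => ?_).trans_eq (by ring)
  · exact abs_pair_faberCoeff_le γ t fun z => (hc1 _).trans hn'
  · rw [DiscMeasure.pair_sub]
    exact (abs_pair_faberCoeff_le γ t fun z => hc y w z).trans_eq (by ring)

/-- The coefficients of the kernel decay with the larger of the two levels. -/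
theorem abs_coeff_expKernel_le {n : ℕ} (hn : 1 ≤ n) (γ : ℝ) {α : ℝ} (h0 : 0 < α) (h1 : α ≤ 1)
    (q : FaberIndex n × FaberIndex n) :
    |((faberCoeff γ q.1).tensor (faberCoeff γ q.2)).pair (expKernel n α)| ≤
      2 * n ^ 2 * ((2 : ℝ) ^ (γ * (q.1.1 : ℝ)) * (2 : ℝ) ^ (γ * (q.2.1 : ℝ))) *
        (2 : ℝ) ^ (-(α * max (q.1.1 : ℝ) (q.2.1 : ℝ))) := by
  rw [DiscMeasure.pair_tensor]
  rcases le_total (q.1.1 : ℝ) (q.2.1 : ℝ) with h | h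
  · rw [max_eq_right h, DiscMeasure.pair_pair_comm, mul_comm ((2 : ℝ) ^ (γ * (q.1.1 : ℝ)))]
    refine abs_pair_pair_le_of_holder hn γ h0.le h1 q.2 q.1 (fun p => expKernel n α (p.2, p.1))
      (fun p => abs_expKernel_le_one _) fun y w z => ?_
    simpa [dist_self] using abs_expKernel_sub_le hn h0.le h1 (z, y) (z, w)
  · rw [max_eq_left h]
    refine abs_pair_pair_le_of_holder hn γ h0.le h1 q.1 q.2 _
      (fun p => abs_expKernel_le_one _) fun y w z => ?_
    simpa [dist_self] using abs_expKernel_sub_le hn h0.le h1 (y, z) (w, z)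

/-- The product of the coefficient bound and the size of the functions at the levels `(k, l)`
decays geometrically, because `γ < α`. -/
theorem coeff_mul_size_le {α γ : ℝ} (hγ0 : 0 < γ) (hγα : γ < α) (k l : ℝ) :
    ((2 : ℝ) ^ (γ * k) * (2 : ℝ) ^ (γ * l)) * (2 : ℝ) ^ (-(α * max k l)) *
      ((2 : ℝ) ^ (-(γ * k)) + (2 : ℝ) ^ (-(γ * l))) ≤
      2 * ((2 : ℝ) ^ (-((α - γ) / 2 * k)) * (2 : ℝ) ^ (-((α - γ) / 2 * l))) := by
  have hk := le_max_left k l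
  have hl := le_max_right k l
  set m := max k l
  have hm : -((α - γ) * m) ≤ -((α - γ) / 2 * k) + -((α - γ) / 2 * l) := by nlinarith
  rw [mul_add, ← Real.rpow_add two_pos, ← Real.rpow_add two_pos, ← Real.rpow_add two_pos,
    ← Real.rpow_add two_pos, ← Real.rpow_add two_pos, two_mul]
  refine add_le_add ?_ ?_ <;> refine Real.rpow_le_rpow_of_exponent_le one_le_two ?_ <;> nlinarith

/-! ### The double series -/

/-- The levels of a pair of nodes. -/
def levels {n : ℕ} (q : FaberIndex n × FaberIndex n) : ℕ × ℕ := (q.1.1, q.2.1)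

/-- Summation of a finite family level by level, where coefficients are estimated by a bound `A`
and functions by a bound `E` on their total size at each pair of levels. -/
theorem sum_mul_le_sum_levels {n : ℕ} (S : Finset (FaberIndex n × FaberIndex n))
    {a G : FaberIndex n × FaberIndex n → ℝ} {A E : ℕ × ℕ → ℝ} (hA0 : ∀ l, 0 ≤ A l)
    (ha : ∀ q, a q ≤ A (levels q)) (hG : ∀ q, 0 ≤ G q)
    (hE : ∀ k l, ∑ τ : {τ : Cube n // τ ∈ dyadicNodes n k},
      ∑ t : {τ : Cube n // τ ∈ dyadicNodes n l}, G (⟨k, τ⟩, ⟨l, t⟩) ≤ E (k, l)) :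
    ∑ q ∈ S, a q * G q ≤ ∑ l ∈ S.image levels, A l * E l := by
  classical
  rw [← Finset.sum_fiberwise_of_maps_to fun q hq => Finset.mem_image_of_mem levels hq]
  refine Finset.sum_le_sum fun l _ => ?_
  obtain ⟨k, l⟩ := l
  have hsub : (S.filter fun q => levels q = (k, l)) ⊆
      (({k} : Finset ℕ).sigma fun _ => Finset.univ) ×ˢ
        (({l} : Finset ℕ).sigma fun _ => Finset.univ) := by
    intro q hq
    have h := (Finset.mem_filter.1 hq).2
    simp only [levels, Prod.mk.injEq] at h
    simp [h.1, h.2]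
  calc ∑ q ∈ S with levels q = (k, l), a q * G q
      ≤ ∑ q ∈ S with levels q = (k, l), A (k, l) * G q := by
        refine Finset.sum_le_sum fun q hq => mul_le_mul_of_nonneg_right ?_ (hG q)
        rw [← (Finset.mem_filter.1 hq).2]
        exact ha q
    _ ≤ A (k, l) * ∑ q ∈ (({k} : Finset ℕ).sigma fun _ => Finset.univ) ×ˢ
        (({l} : Finset ℕ).sigma fun _ => Finset.univ), G q := by
        rw [← Finset.mul_sum]
        exact mul_le_mul_of_nonneg_left
          (Finset.sum_le_sum_of_subset_of_nonneg hsub fun q _ _ => hG q) (hA0 _)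
    _ ≤ A (k, l) * E (k, l) := by
        refine mul_le_mul_of_nonneg_left ?_ (hA0 _)
        rw [Finset.sum_product, Finset.sum_sigma, Finset.sum_singleton]
        simp only [Finset.sum_sigma, Finset.sum_singleton]
        exact hE k l

theorem rpow_neg_level_le_one {γ : ℝ} (hγ0 : 0 < γ) (k : ℕ) : (2 : ℝ) ^ (-(γ * (k : ℝ))) ≤ 1 :=
  Real.rpow_le_one_of_one_le_of_nonpos one_le_two (by have := k.cast_nonneg (α := ℝ); nlinarith)

theorem sum_abs_tensorFun_faber_le {n : ℕ} {γ : ℝ} (hγ0 : 0 < γ) (k l : ℕ) (x x' : Cube n) :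
    ∑ τ : {τ : Cube n // τ ∈ dyadicNodes n k}, ∑ t : {τ : Cube n // τ ∈ dyadicNodes n l},
      |faber γ ⟨k, τ⟩ x * faber γ ⟨l, t⟩ x'| ≤
      (2 : ℝ) ^ (-(γ * (k : ℝ))) + (2 : ℝ) ^ (-(γ * (l : ℝ))) := by
  simp only [abs_mul, ← Finset.mul_sum, ← Finset.sum_mul]
  have h1 := sum_abs_faber_le γ k x
  have h2 := (sum_abs_faber_le γ l x').trans (rpow_neg_level_le_one hγ0 l)
  have h3 : (0 : ℝ) < (2 : ℝ) ^ (-(γ * (l : ℝ))) := Real.rpow_pos_of_pos two_pos _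
  have h4 := mul_le_mul h1 h2 (Finset.sum_nonneg fun _ _ => abs_nonneg _)
    (Real.rpow_pos_of_pos two_pos _).le
  linarith

theorem abs_mul_sub_mul_le (a b c d : ℝ) : |a * b - c * d| ≤ |a - c| * |b| + |c| * |b - d| := by
  rw [← abs_mul, ← abs_mul, show a * b - c * d = (a - c) * b + c * (b - d) by ring]
  exact abs_add_le _ _

theorem sum_abs_tensorFun_faber_sub_le {n : ℕ} (hn : 1 ≤ n) {γ : ℝ} (hγ0 : 0 < γ) (hγ1 : γ ≤ 1)
    (k l : ℕ) (x x' y y' : Cube n) {d : ℝ} (hx : dist x y ^ γ ≤ d) (hx' : dist x' y' ^ γ ≤ d) :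
    ∑ τ : {τ : Cube n // τ ∈ dyadicNodes n k}, ∑ t : {τ : Cube n // τ ∈ dyadicNodes n l},
      |faber γ ⟨k, τ⟩ x * faber γ ⟨l, t⟩ x' - faber γ ⟨k, τ⟩ y * faber γ ⟨l, t⟩ y'| ≤
      2 ^ (n + 1) * n * ((2 : ℝ) ^ (-(γ * (k : ℝ))) + (2 : ℝ) ^ (-(γ * (l : ℝ)))) * d := by
  have hd : 0 ≤ d := (Real.rpow_nonneg dist_nonneg _).trans hx
  refine (Finset.sum_le_sum fun τ _ => Finset.sum_le_sum fun t _ =>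
    abs_mul_sub_mul_le _ _ _ _).trans ?_
  simp only [Finset.sum_add_distrib, ← Finset.mul_sum, ← Finset.sum_mul]
  have h1 := (sum_abs_faber_sub_le hn hγ0 hγ1 k x y).trans
    (mul_le_mul_of_nonneg_left hx (by positivity))
  have h2 := (sum_abs_faber_sub_le hn hγ0 hγ1 l x' y').trans
    (mul_le_mul_of_nonneg_left hx' (by positivity))
  have h3 := mul_le_mul h1 (sum_abs_faber_le γ l x') (Finset.sum_nonneg fun _ _ => abs_nonneg _)
    (by positivity)
  have h4 := mul_le_mul (sum_abs_faber_le γ k y) h2 (Finset.sum_nonneg fun _ _ => abs_nonneg _)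
    (by positivity)
  linarith

theorem abs_faber_le_one {n : ℕ} {γ : ℝ} (hγ0 : 0 < γ) (τ : FaberIndex n) (x : Cube n) :
    |faber γ τ x| ≤ 1 := by
  obtain ⟨k, τ⟩ := τ
  rw [faber_eq, abs_mul, abs_of_nonneg (bump_nonneg _ _ _),
    abs_of_pos (Real.rpow_pos_of_pos two_pos _)]
  exact mul_le_one₀ (rpow_neg_level_le_one hγ0 k) (bump_nonneg _ _ _) (bump_le_one _ _ _)

theorem abs_faber_sub_le {n : ℕ} {γ : ℝ} (hγ0 : 0 < γ) (τ : FaberIndex n) (x y : Cube n) :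
    |faber γ τ x - faber γ τ y| ≤ n * 2 ^ τ.1 * dist x y := by
  obtain ⟨k, τ⟩ := τ
  rw [faber_eq, faber_eq, ← mul_sub, abs_mul, abs_of_pos (Real.rpow_pos_of_pos two_pos _),
    mul_assoc]
  exact (mul_le_of_le_one_left (abs_nonneg _) (rpow_neg_level_le_one hγ0 k)).trans
    (abs_bump_sub_bump_le k _ x y)

theorem abs_tensorFun_faber_sub_le {n : ℕ} {γ : ℝ} (hγ0 : 0 < γ)
    (q : FaberIndex n × FaberIndex n) (p r : Cube n × Cube n) {δ : ℝ} (h1 : dist p.1 r.1 ≤ δ)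
    (h2 : dist p.2 r.2 ≤ δ) :
    |tensorFun (faber γ q.1) (faber γ q.2) p - tensorFun (faber γ q.1) (faber γ q.2) r| ≤
      n * (2 ^ q.1.1 + 2 ^ q.2.1) * δ := by
  have hδ : 0 ≤ δ := dist_nonneg.trans h1
  refine (abs_mul_sub_mul_le _ _ _ _).trans ?_
  have h3 := (abs_faber_sub_le hγ0 q.1 p.1 r.1).trans (mul_le_mul_of_nonneg_left h1 (by positivity))
  have h4 := (abs_faber_sub_le hγ0 q.2 p.2 r.2).trans (mul_le_mul_of_nonneg_left h2 (by positivity))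
  have h5 := mul_le_mul h3 (abs_faber_le_one hγ0 q.2 p.2) (abs_nonneg _) (by positivity)
  have h6 := mul_le_mul (abs_faber_le_one hγ0 q.1 r.1) h4 (abs_nonneg _) zero_le_one
  linarith

/-! ### Pointwise convergence -/

/-- A hat function that does not vanish at `x` is centred close to `x`. -/
theorem dist_toCube_le_of_bump_ne_zero {n k : ℕ} {σ : Fin n → ℝ} (hσ : σ ∈ gridPi n k) {x : Cube n}
    (h : bump k σ (coords x) ≠ 0) : dist (toCube σ) x ≤ n * (1 / 2 ^ k) := by
  refine dist_le_of_abs_coords_sub_le (by positivity) fun i => ?_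
  rw [coords_toCube fun i => grid_nonneg_le_one (mem_gridPi.1 hσ i), abs_sub_comm]
  rw [bump, Finset.prod_ne_zero_iff] at h
  have hi := mt hat_eq_zero (h i (Finset.mem_univ i))
  rw [not_le, abs_mul, abs_of_pos (by positivity)] at hi
  rw [le_div_iff₀ (by positivity), mul_comm]
  exact hi.le

/-- The iterated interpolations of the kernel converge to it pointwise. -/
theorem tendsto_sum_expKernel {n : ℕ} (hn : 1 ≤ n) {α γ : ℝ} (h0 : 0 < α) (h1 : α ≤ 1)
    (p : Cube n × Cube n) :
    Tendsto (fun K => ∑ q ∈ nodesUpTo n K ×ˢ nodesUpTo n K,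
      ((faberCoeff γ q.1).tensor (faberCoeff γ q.2)).pair (expKernel n α) *
        tensorFun (faber γ q.1) (faber γ q.2) p) atTop (𝓝 (expKernel n α p)) := by
  obtain ⟨x, x'⟩ := p
  have hlim : Tendsto (fun K : ℕ => n * (n * (1 / 2 ^ K) + n * (1 / 2 ^ K) : ℝ) ^ α) atTop
      (𝓝 0) := by
    have h2 : Tendsto (fun K : ℕ => (1 / 2 ^ K : ℝ)) atTop (𝓝 0) := by
      simpa using tendsto_pow_atTop_nhds_zero_of_lt_one (r := (1 / 2 : ℝ)) (by norm_num)
        (by norm_num)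
    have h3 := (((h2.const_mul (n : ℝ)).add (h2.const_mul (n : ℝ))).rpow_const
      (Or.inr h0.le) (p := α)).const_mul (n : ℝ)
    simpa [Real.zero_rpow h0.ne'] using h3
  rw [tendsto_iff_dist_tendsto_zero]
  refine squeeze_zero (fun _ => dist_nonneg) (fun K => ?_) hlim
  have hsum : ∑ σ ∈ gridPi n K, ∑ σ' ∈ gridPi n K,
      bump K σ (coords x) * bump K σ' (coords x') = 1 := by
    rw [← Finset.sum_mul_sum, sum_gridPi_bump K (x := coords x) x.2,
      sum_gridPi_bump K (x := coords x') x'.2, one_mul]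
  change dist (∑ q ∈ nodesUpTo n K ×ˢ nodesUpTo n K,
      ((faberCoeff γ q.1).tensor (faberCoeff γ q.2)).pair (expKernel n α) *
        (faber γ q.1 x * faber γ q.2 x')) _ ≤ _
  rw [sum_nodesUpTo_product hn, Real.dist_eq]
  -- Both sides are averages with respect to the weights given by the two partitions of unity.
  calc |∑ σ ∈ gridPi n K, ∑ σ' ∈ gridPi n K, expKernel n α (toCube σ, toCube σ') *
          (bump K σ (coords x) * bump K σ' (coords x')) - expKernel n α (x, x')|
      = |∑ σ ∈ gridPi n K, ∑ σ' ∈ gridPi n K,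
          (expKernel n α (toCube σ, toCube σ') - expKernel n α (x, x')) *
          (bump K σ (coords x) * bump K σ' (coords x'))| := by
        simp only [sub_mul, Finset.sum_sub_distrib, ← Finset.mul_sum _ _ (expKernel n α (x, x'))]
        simp only [hsum, mul_one]
    _ ≤ ∑ σ ∈ gridPi n K, ∑ σ' ∈ gridPi n K,
          (n * (n * (1 / 2 ^ K) + n * (1 / 2 ^ K) : ℝ) ^ α) *
          (bump K σ (coords x) * bump K σ' (coords x')) := by
        refine (Finset.abs_sum_le_sum_abs _ _).trans (Finset.sum_le_sum fun σ hσ =>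
          (Finset.abs_sum_le_sum_abs _ _).trans (Finset.sum_le_sum fun σ' hσ' => ?_))
        have hb := mul_nonneg (bump_nonneg K σ (coords x)) (bump_nonneg K σ' (coords x'))
        rw [abs_mul, abs_of_nonneg hb]
        rcases eq_or_ne (bump K σ (coords x)) 0 with e | e
        · simp [e]
        rcases eq_or_ne (bump K σ' (coords x')) 0 with e' | e'
        · simp [e']
        refine mul_le_mul_of_nonneg_right ((abs_expKernel_sub_le hn h0.le h1 _ _).trans ?_) hb
        have d1 := dist_toCube_le_of_bump_ne_zero hσ e
        have d2 := dist_toCube_le_of_bump_ne_zero hσ' e'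
        dsimp only
        gcongr
    _ = n * (n * (1 / 2 ^ K) + n * (1 / 2 ^ K) : ℝ) ^ α := by
        simp only [mul_assoc (n : ℝ), ← Finset.mul_sum _ _ (n : ℝ)]
        simp only [← Finset.mul_sum _ _ ((_ : ℝ) ^ α), hsum, mul_one]

/-! ### Convergence of the series in `lip(X^γ × X^γ)` -/

/-- The bound for the coefficients at the pair of levels `l`. -/
def coeffBound (n : ℕ) (α γ : ℝ) (l : ℕ × ℕ) : ℝ :=
  2 * n ^ 2 * ((2 : ℝ) ^ (γ * (l.1 : ℝ)) * (2 : ℝ) ^ (γ * (l.2 : ℝ))) *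
    (2 : ℝ) ^ (-(α * max (l.1 : ℝ) (l.2 : ℝ)))

/-- The bound for the norms of the partial sums at the pair of levels `l`: the bound for the
coefficients times the bound for the total size of the functions. -/
def levelBound (n : ℕ) (α γ : ℝ) (l : ℕ × ℕ) : ℝ :=
  coeffBound n α γ l *
    (2 ^ (n + 1) * n * ((2 : ℝ) ^ (-(γ * (l.1 : ℝ))) + (2 : ℝ) ^ (-(γ * (l.2 : ℝ)))))

theorem coeffBound_nonneg (n : ℕ) (α γ : ℝ) (l : ℕ × ℕ) : 0 ≤ coeffBound n α γ l := by
  unfold coeffBound; positivity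

theorem levelBound_nonneg (n : ℕ) (α γ : ℝ) (l : ℕ × ℕ) : 0 ≤ levelBound n α γ l :=
  mul_nonneg (coeffBound_nonneg n α γ l) (by positivity)

theorem summable_levelBound (n : ℕ) {α γ : ℝ} (hγ0 : 0 < γ) (hγα : γ < α) :
    Summable (levelBound n α γ) := by
  set r : ℝ := (2 : ℝ) ^ (-((α - γ) / 2)) with hr
  have hr0 : 0 ≤ r := (Real.rpow_pos_of_pos two_pos _).le
  have hr1 : r < 1 := Real.rpow_lt_one_of_one_lt_of_neg one_lt_two (by linarith)
  have hgeo := summable_geometric_of_lt_one hr0 hr1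
  have hprod : Summable fun l : ℕ × ℕ => r ^ l.1 * r ^ l.2 :=
    hgeo.mul_of_nonneg hgeo (fun _ => pow_nonneg hr0 _) fun _ => pow_nonneg hr0 _
  refine Summable.of_nonneg_of_le (fun l => ?_) (fun l => ?_)
    (hprod.mul_left (2 * (n : ℝ) ^ 2 * (2 ^ (n + 1) * n) * 2))
  · exact levelBound_nonneg n α γ l
  · have e : ∀ k : ℕ, (2 : ℝ) ^ (-((α - γ) / 2 * (k : ℝ))) = r ^ k := fun k => by
      rw [hr, ← Real.rpow_natCast, ← Real.rpow_mul two_pos.le, neg_mul]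
    have h := coeff_mul_size_le hγ0 hγα l.1 l.2
    rw [e, e] at h
    have h' := mul_le_mul_of_nonneg_left h
      (show (0 : ℝ) ≤ 2 * n ^ 2 * (2 ^ (n + 1) * n) by positivity)
    unfold levelBound coeffBound
    linarith

theorem tendsto_nodesUpTo_product (n : ℕ) :
    Tendsto (fun K => nodesUpTo n K ×ˢ nodesUpTo n K) atTop atTop := by
  refine tendsto_atTop_finset_of_monotone (fun K L h q hq => ?_) fun q => ⟨max q.1.1 q.2.1, ?_⟩
  · rw [Finset.mem_product, mem_nodesUpTo, mem_nodesUpTo] at hq ⊢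
    exact ⟨hq.1.trans h, hq.2.trans h⟩
  · rw [Finset.mem_product, mem_nodesUpTo, mem_nodesUpTo]
    exact ⟨le_max_left _ _, le_max_right _ _⟩

/-- A family whose finite partial sums are bounded by the sum of a summable function over the
occurring pairs of levels has a Cauchy net of partial sums, since each pair of levels contains only
finitely many pairs of nodes. -/
theorem cauchySeq_of_levels {n : ℕ} {E : Type*} [NormedAddCommGroup E]
    {f : FaberIndex n × FaberIndex n → E} {B : ℕ × ℕ → ℝ} (hB : Summable B)
    (h : ∀ S, ‖∑ q ∈ S, f q‖ ≤ ∑ l ∈ S.image levels, B l) :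
    CauchySeq fun S : Finset (FaberIndex n × FaberIndex n) => ∑ q ∈ S, f q := by
  classical
  refine cauchySeq_finset_iff_vanishing_norm.2 fun ε hε => ?_
  obtain ⟨s, hs⟩ := summable_iff_vanishing_norm.1 hB ε hε
  let K := s.sup fun l => max l.1 l.2
  refine ⟨nodesUpTo n K ×ˢ nodesUpTo n K, fun S hS => (h S).trans_lt ?_⟩
  refine (le_abs_self _).trans_lt (hs _ (Finset.disjoint_left.2 fun l hl hls => ?_))
  obtain ⟨q, hq, rfl⟩ := Finset.mem_image.1 hl
  refine Finset.disjoint_left.1 hS hq ?_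
  have hle : max q.1.1 q.2.1 ≤ K := Finset.le_sup (f := fun l : ℕ × ℕ => max l.1 l.2) hls
  rw [Finset.mem_product, mem_nodesUpTo, mem_nodesUpTo]
  exact ⟨(le_max_left _ _).trans hle, (le_max_right _ _).trans hle⟩

section Snowflake

variable {n : ℕ} {γ : ℝ} {h0 : 0 < γ} {h1 : γ ≤ 1}

theorem SnowCubeSq.rpow_dist_fst_le (p r : SnowCubeSq n γ h0 h1) :
    dist p.toPair.1 r.toPair.1 ^ γ ≤ dist p r := le_max_left _ _

theorem SnowCubeSq.rpow_dist_snd_le (p r : SnowCubeSq n γ h0 h1) :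
    dist p.toPair.2 r.toPair.2 ^ γ ≤ dist p r := le_max_right _ _

theorem SnowCubeSq.dist_fst_le (p r : SnowCubeSq n γ h0 h1) :
    dist p.toPair.1 r.toPair.1 ≤ dist p r ^ γ⁻¹ := by
  rw [Real.le_rpow_inv_iff_of_pos dist_nonneg dist_nonneg h0]
  exact rpow_dist_fst_le p r

theorem SnowCubeSq.dist_snd_le (p r : SnowCubeSq n γ h0 h1) :
    dist p.toPair.2 r.toPair.2 ≤ dist p r ^ γ⁻¹ := by
  rw [Real.le_rpow_inv_iff_of_pos dist_nonneg dist_nonneg h0]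
  exact rpow_dist_snd_le p r

/-- The kernel is Hölder continuous of exponent `α / γ > 1` on the snowflake. -/
theorem SnowCubeSq.abs_expKernel_sub_le (hn : 1 ≤ n) {α : ℝ} (hα0 : 0 ≤ α) (hα1 : α ≤ 1)
    (p r : SnowCubeSq n γ h0 h1) :
    |expKernel n α p.toPair - expKernel n α r.toPair| ≤ n * 2 ^ α * dist p r ^ (α / γ) := by
  refine (HolderFaber.abs_expKernel_sub_le hn hα0 hα1 _ _).trans ?_
  rw [mul_assoc]
  refine mul_le_mul_of_nonneg_left ?_ n.cast_nonneg
  rw [div_eq_inv_mul, Real.rpow_mul dist_nonneg, ← Real.mul_rpow two_pos.le (by positivity)]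
  refine Real.rpow_le_rpow (by positivity) ?_ hα0
  linarith [dist_fst_le p r, dist_snd_le p r]

/-- The kernel as an element of `Lip(X^γ × X^γ)`. -/
def kernelLip (hn : 1 ≤ n) {α : ℝ} (hγα : γ < α) (hα1 : α ≤ 1) : LipSpace (SnowCubeSq n γ h0 h1) :=
  ⟨fun p => expKernel n α p.toPair,
    mem_lipSubmodule_of_holder (fun _ => abs_expKernel_le_one _) ((one_lt_div h0).2 hγα)
      (by positivity) (SnowCubeSq.abs_expKernel_sub_le hn (h0.trans hγα).le hα1)⟩

/-- The function `f̃_τ ⊗ f̃_t` as an element of `Lip(X^γ × X^γ)`, for `γ < 1`. -/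
def faberLip (hγ1 : γ < 1) (q : FaberIndex n × FaberIndex n) : LipSpace (SnowCubeSq n γ h0 h1) :=
  ⟨fun p => tensorFun (faber γ q.1) (faber γ q.2) p.toPair,
    mem_lipSubmodule_of_holder (B := 1) (A := n * (2 ^ q.1.1 + 2 ^ q.2.1)) (θ := γ⁻¹)
      (fun p => by
        rw [tensorFun, abs_mul]
        exact mul_le_one₀ (abs_faber_le_one h0 _ _) (abs_nonneg _) (abs_faber_le_one h0 _ _))
      ((one_lt_inv₀ h0).2 hγ1) (by positivity)
      fun p r => abs_tensorFun_faber_sub_le h0 q _ _ (SnowCubeSq.dist_fst_le p r)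
        (SnowCubeSq.dist_snd_le p r)⟩

theorem kernelLip_mem_littleLip (hn : 1 ≤ n) {α : ℝ} (hγα : γ < α) (hα1 : α ≤ 1) :
    (kernelLip hn hγα hα1 : LipSpace (SnowCubeSq n γ h0 h1)) ∈ littleLip (SnowCubeSq n γ h0 h1) :=
  mem_littleLip_of_holder ((one_lt_div h0).2 hγα) (by positivity)
    (SnowCubeSq.abs_expKernel_sub_le hn (h0.trans hγα).le hα1)

theorem faberLip_mem_littleLip (hγ1 : γ < 1) (q : FaberIndex n × FaberIndex n) :
    (faberLip hγ1 q : LipSpace (SnowCubeSq n γ h0 h1)) ∈ littleLip (SnowCubeSq n γ h0 h1) :=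
  mem_littleLip_of_holder (A := n * (2 ^ q.1.1 + 2 ^ q.2.1)) ((one_lt_inv₀ h0).2 hγ1)
    (by positivity) fun p r => abs_tensorFun_faber_sub_le h0 q _ _ (SnowCubeSq.dist_fst_le p r)
      (SnowCubeSq.dist_snd_le p r)

theorem norm_sum_faberLip_le (hn : 1 ≤ n) {α : ℝ} (hγα : γ < α) (hα1 : α < 1)
    (S : Finset (FaberIndex n × FaberIndex n)) :
    ‖∑ q ∈ S, ((faberCoeff γ q.1).tensor (faberCoeff γ q.2)).pair (expKernel n α) •
        (faberLip (hγα.trans hα1) q : LipSpace (SnowCubeSq n γ h0 h1))‖ ≤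
      ∑ l ∈ S.image levels, levelBound n α γ l := by
  have hn' : (1 : ℝ) ≤ n := by exact_mod_cast hn
  have hC : (1 : ℝ) ≤ 2 ^ (n + 1) * n :=
    one_le_mul_of_one_le_of_one_le (one_le_pow₀ one_le_two) hn'
  refine LipSpace.norm_le_of (Finset.sum_nonneg fun l _ => levelBound_nonneg n α γ l)
    (fun p => ?_) fun p r => ?_
  · rw [LipSpace.sum_apply]
    simp only [LipSpace.smul_apply]
    refine (Finset.abs_sum_le_sum_abs _ _).trans ?_
    simp only [abs_mul]
    refine sum_mul_le_sum_levels S (coeffBound_nonneg n α γ)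
      (abs_coeff_expKernel_le hn γ (h0.trans hγα) hα1.le) (fun _ => abs_nonneg _) fun k l => ?_
    exact (sum_abs_tensorFun_faber_le h0 k l p.toPair.1 p.toPair.2).trans
      (le_mul_of_one_le_left (by positivity) hC)
  · refine div_le_of_le_mul₀ dist_nonneg (Finset.sum_nonneg fun l _ => levelBound_nonneg n α γ l) ?_
    rw [LipSpace.sum_apply, LipSpace.sum_apply, ← Finset.sum_sub_distrib]
    simp only [LipSpace.smul_apply, ← mul_sub]
    refine (Finset.abs_sum_le_sum_abs _ _).trans ?_
    simp only [abs_mul]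
    refine (sum_mul_le_sum_levels S
      (E := fun l => 2 ^ (n + 1) * n *
        ((2 : ℝ) ^ (-(γ * (l.1 : ℝ))) + (2 : ℝ) ^ (-(γ * (l.2 : ℝ)))) * dist p r)
      (coeffBound_nonneg n α γ)
      (abs_coeff_expKernel_le hn γ (h0.trans hγα) hα1.le) (fun _ => abs_nonneg _) fun k l =>
        sum_abs_tensorFun_faber_sub_le hn h0 h1 k l p.toPair.1 p.toPair.2 r.toPair.1 r.toPair.2
          (SnowCubeSq.rpow_dist_fst_le p r) (SnowCubeSq.rpow_dist_snd_le p r)).trans_eq ?_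
    rw [Finset.sum_mul]
    exact Finset.sum_congr rfl fun l _ => (mul_assoc _ _ _).symm

end Snowflake

end HolderFaber

end

open HolderFaber in
theorem mainTheorem8 (n : ℕ) (hn : 1 ≤ n) (α γ : ℝ) (hα1 : α < 1) (hγ0 : 0 < γ) (hγα : γ < α) :
    ∃ (c : littleLip (SnowCubeSq n γ hγ0 (hγα.trans hα1).le))
      (F : FaberIndex n × FaberIndex n → littleLip (SnowCubeSq n γ hγ0 (hγα.trans hα1).le)),
      (∀ p, c.1 p = expKernel n α p.toPair) ∧
      (∀ q p, (F q).1 p = tensorFun (faber γ q.1) (faber γ q.2) p.toPair) ∧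
      HasSum
        (fun q : FaberIndex n × FaberIndex n =>
          ((faberCoeff γ q.1).tensor (faberCoeff γ q.2)).pair (expKernel n α) • F q)
        c := by
  refine ⟨⟨kernelLip hn hγα hα1.le, kernelLip_mem_littleLip hn hγα hα1.le⟩,
    fun q => ⟨faberLip (hγα.trans hα1) q, faberLip_mem_littleLip (hγα.trans hα1) q⟩,
    fun _ => rfl, fun _ _ => rfl, ?_⟩
  rw [← (Topology.IsInducing.subtypeVal.hasSum_iff
    (g := (littleLip (SnowCubeSq n γ hγ0 (hγα.trans hα1).le)).subtype) _ _)]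
  exact LipSpace.hasSum_of_cauchySeq
    (cauchySeq_of_levels (summable_levelBound n hγ0 hγα) (norm_sum_faberLip_le hn hγα hα1))
    (tendsto_nodesUpTo_product n)
    fun p => tendsto_sum_expKernel hn (hγ0.trans hγα) hα1.le p.toPair
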